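/- Let $n\ge 1$ and $0\le p\le 1$. On the cycle $[n]=\{1,\dots,n\}$ let $C(x,y,z)$ be the clockwise relation: $x<y<z$ or $y<z<x$ or $z<x<y$. The random unary predicate $U_{n,p}$ is the random subset $U\subseteq[n]$ that contains each element independently with probability $p$. Sentences are first-order sentences in the language with equality, the unary predicate $U$ and the ternary predicate $C$ ("circular sentences"). A function $p=p(n)\in[0,1]$ *satisfies the Zero-One Law for circular unary predicates* if for every circular sentence $S$ the limit $\lim_{n\to\infty}\Pr[U_{n,p(n)}\models S]$ exists and equals $0$ or $1$. Write $f\ll g$ for $f(n)=o(g(n))$ as $n\to\infty$. **Theorem 1.** Let $p(n)\in[0,1]$ for all $n$. Then $p(n)$ satisfies the Zero-One Law for circular unary predicates if and only if at least one of the following holds: 1. $p(n)\ll n^{-1}$; 2. $n^{-1/k}\ll p(n)\ll n^{-1/(k+1)}$ for some positive integer $k$; 3. $n^{-\epsilon}\ll p(n)$ and $n^{-\epsilon}\ll 1-p(n)$ for every $\epsilon>0$; 4. $n^{-1/k}\ll 1-p(n)\ll n^{-1/(k+1)}$ for some positive integer $k$; 5. $1-p(n)\ll n^{-1}$. Moreover,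 for every positive integer $k$ there is a circular sentence $A_k$ that, for all $n\ge k$, holds if and only if some $k$ cyclically consecutive elements of $[n]$ all lie in $U$; and whenever $c>0$ is a constant and $p(n)\in[0,1]$ satisfies $p(n)\sim c\,n^{-1/k}$, the probability $\Pr[U_{n,p(n)}\models A_k]$ converges to a limit strictly between $0$ and $1$ as $n\to\infty$. -/

import Mathlib

open Filter Topology Asymptotics

namespace CircularPredicate

/-- The relation symbols of the circular language: a unary predicate `U` and a ternary
predicate `C`. -/
inductive Rel : ℕ → Type
  | U : Rel 1
  | C : Rel 3

/-- The (relational) first-order language with equality, the unary predicate symbol `U` and the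
ternary predicate symbol `C`. -/
def circular : FirstOrder.Language := ⟨fun _ => Empty, Rel⟩

/-- `x` to `y` to `z` goes in a clockwise direction on the cycle `Fin n`. -/
def Clockwise {n : ℕ} (x y z : Fin n) : Prop :=
  (x < y ∧ y < z) ∨ (y < z ∧ z < x) ∨ (z < x ∧ x < y)

/-- The model on the cycle with `n` elements (represented by `Fin n`) in which `U` is interpreted
as membership in the given set and `C` as the clockwise relation. -/
@[reducible]
def model (n : ℕ) (U : Set (Fin n)) : circular.Structure (Fin n) where
  funMap := fun f _ => f.elim
  RelMap := fun r x =>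
    match r, x with
    | Rel.U, x => x 0 ∈ U
    | Rel.C, x => Clockwise (x 0) (x 1) (x 2)

/-- The sentence `S` holds in the cycle with `n` elements and unary predicate `U`. -/
def Holds (n : ℕ) (U : Set (Fin n)) (S : circular.Sentence) : Prop :=
  letI := model n U
  S.Realize (Fin n)

/-- The probability that `S` holds for the random unary predicate in which every element of the
cycle with `n` elements satisfies `U` with probability `p`, independently. -/
noncomputable def prob (n : ℕ) (p : unitInterval) (S : circular.Sentence) : ℝ :=
  (ProbabilityTheory.setBernoulli (Set.univ : Set (Fin n)) p).real {U | Holds n U S}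

/-- `p = p(n)` satisfies the Zero-One Law for circular unary predicates. -/
def ZeroOneLaw (p : ℕ → unitInterval) : Prop :=
  ∀ S : circular.Sentence,
    Tendsto (fun n => prob n (p n) S) atTop (𝓝 0) ∨
    Tendsto (fun n => prob n (p n) S) atTop (𝓝 1)

/-- Some `k` cyclically consecutive elements `i, i + 1, …, i + k - 1` (modulo `n`) all lie
in `U`. -/
def HasRun (k n : ℕ) (U : Set (Fin n)) : Prop :=
  ∃ i : Fin n, ∀ j : ℕ, j < k → (⟨((i : ℕ) + j) % n, Nat.mod_lt _ i.pos⟩ : Fin n) ∈ U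

end CircularPredicate

/-! Cut the cycle open to get a word. By Ehrenfeucht–Fraïssé games the truth of a sentence depends
only on a rank `q` type of this word, and the types form a finite monoid, aperiodic because high
powers of a word have equal types (`exists_recognizer`). The question becomes where the value `φ w`
of a random word falls in a finite aperiodic monoid.

The probability `a n` that a word of length `n` avoids a given two-sided ideal is submultiplicative.
With `T = ∑ a i`, the mean hitting time, avoidance at time `m` has probability at most `T / m` and
hitting by time `m` at most `m / T`. A linear system and Cramer's rule show that `T` is a rational
function of `p` (`exists_polynomial_tendsto`), so unless it vanishes it has an integral order at `p
= 0`. If `n p ^ k → ∞` and `n p ^ (k + 1) → 0`, then `T` is either `O(p ^ (-k))`, much less than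
`n`, or at least of order `p ^ (-(k + 1))`, much more than `n`: every ideal is hit, or every trace
of it avoided, with probability tending to one. Hence the value concentrates on one `𝒥`-class. For
the halves `u`, `v` of a random word this applies to `u`, `v`, `uv` and `vu`; the class then
contains an idempotent `e`, and aperiodicity makes a rotation-invariant property of `uv` agree with
that of `e` (`circular_eq_idempotent`). In the middle range all ideals are hit; if `n p → 0` the
word is almost surely all `false`. Negating letters exchanges `p` and `1 - p`.

Conversely, the probability of no circular run of length `k` is squeezed around `exp (-n p ^ k)`, by
Harris's inequality from below and a recursion from above. A zero-one law for runs therefore forces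
`n p ^ k` to tend to `0` or `∞` for every `k`, and likewise for `1 - p`; this yields the five
ranges. -/

namespace CircularPredicate

/-! ### Ehrenfeucht–Fraïssé types of words -/

/-- The finite set of possible rank `q` types of words over `α`. -/
def WordType (α : Type) : ℕ → Type
  | 0 => Unit
  | q + 1 => Set (WordType α q × α × WordType α q)

/-- The rank `q` Ehrenfeucht–Fraïssé type of a word, as a linear order with labels in `α`. -/
def wordType {α : Type} : (q : ℕ) → List α → WordType α q
  | 0, _ => ()
  | q + 1, w => {t : WordType α q × α × WordType α q |
      ∃ u a v, w = u ++ a :: v ∧ t = (wordType q u, a, wordType q v)}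

instance WordType.finite (α : Type) [Finite α] : ∀ q, Finite (WordType α q)
  | 0 => inferInstanceAs (Finite Unit)
  | q + 1 =>
    have := WordType.finite α q
    inferInstanceAs (Finite (Set (WordType α q × α × WordType α q)))

section WordType

variable {α β : Type}

theorem wordType_split {q : ℕ} {w w' : List α} (h : wordType (q + 1) w = wordType (q + 1) w')
    {u : List α} {a : α} {v : List α} (hw : w = u ++ a :: v) :
    ∃ u' v', w' = u' ++ a :: v' ∧ wordType q u = wordType q u' ∧ wordType q v = wordType q v' := by
  have h0 : {t : WordType α q × α × WordType α q |
        ∃ u a v, w = u ++ a :: v ∧ t = (wordType q u, a, wordType q v)} =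
      {t | ∃ u a v, w' = u ++ a :: v ∧ t = (wordType q u, a, wordType q v)} := h
  have h1 : (wordType q u, a, wordType q v) ∈ {t : WordType α q × α × WordType α q |
      ∃ u a v, w' = u ++ a :: v ∧ t = (wordType q u, a, wordType q v)} := by
    rw [← h0]
    exact ⟨u, a, v, hw, rfl⟩
  obtain ⟨u', a', v', hw', ht⟩ := h1
  simp only [Prod.mk.injEq] at ht
  obtain ⟨h1, rfl, h2⟩ := ht
  exact ⟨u', v', hw', h1, h2⟩

theorem wordType_succ_eq {q : ℕ} {w w' : List α}
    (h : ∀ u a v, w = u ++ a :: v → ∃ u' v', w' = u' ++ a :: v' ∧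
      wordType q u = wordType q u' ∧ wordType q v = wordType q v')
    (h' : ∀ u a v, w' = u ++ a :: v → ∃ u' v', w = u' ++ a :: v' ∧
      wordType q u = wordType q u' ∧ wordType q v = wordType q v') :
    wordType (q + 1) w = wordType (q + 1) w' := by
  refine Set.ext (α := WordType α q × α × WordType α q) fun t => ⟨?_, ?_⟩
  · rintro ⟨u, a, v, hw, rfl⟩
    obtain ⟨u', v', hw', h1, h2⟩ := h u a v hw
    exact ⟨u', a, v', hw', by rw [h1, h2]⟩
  · rintro ⟨u, a, v, hw, rfl⟩
    obtain ⟨u', v', hw', h1, h2⟩ := h' u a v hw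
    exact ⟨u', a, v', hw', by rw [h1, h2]⟩

theorem wordType_of_succ : ∀ {q : ℕ} {w w' : List α},
    wordType (q + 1) w = wordType (q + 1) w' → wordType q w = wordType q w'
  | 0, _, _, _ => rfl
  | q + 1, w, w', h => by
    refine wordType_succ_eq (fun u a v hw => ?_) (fun u a v hw => ?_)
    · obtain ⟨u', v', hw', h1, h2⟩ := wordType_split h hw
      exact ⟨u', v', hw', wordType_of_succ h1, wordType_of_succ h2⟩
    · obtain ⟨u', v', hw', h1, h2⟩ := wordType_split h.symm hw
      exact ⟨u', v', hw', wordType_of_succ h1, wordType_of_succ h2⟩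

theorem wordType_of_le {q r : ℕ} (hqr : q ≤ r) {w w' : List α}
    (h : wordType r w = wordType r w') : wordType q w = wordType q w' := by
  induction hqr with
  | refl => exact h
  | step _ ih => exact ih (wordType_of_succ h)

/-- A letter of `u ++ v` lies in `u` or in `v`: answer inside that factor and apply induction to the
pieces. This makes equality of types a congruence. -/
theorem wordType_append {q : ℕ} {u u' v v' : List α} (hu : wordType q u = wordType q u')
    (hv : wordType q v = wordType q v') : wordType q (u ++ v) = wordType q (u' ++ v') := by
  induction q generalizing u u' v v' with
  | zero => rfl
  | succ q ih =>
    have key : ∀ {u u' v v' : List α}, wordType (q + 1) u = wordType (q + 1) u' →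
        wordType (q + 1) v = wordType (q + 1) v' → ∀ x a y, u ++ v = x ++ a :: y →
        ∃ x' y', u' ++ v' = x' ++ a :: y' ∧
          wordType q x = wordType q x' ∧ wordType q y = wordType q y' := by
      intro u u' v v' hu hv x a y h
      rcases List.append_eq_append_iff.1 h with ⟨s, rfl, hs⟩ | ⟨s, hs, hs'⟩
      · obtain ⟨s', y', hs', h1, h2⟩ := wordType_split hv hs
        exact ⟨u' ++ s', y', by simp [hs'], ih (wordType_of_succ hu) h1, h2⟩
      -- If `s` is empty, the chosen letter is the first of `v` and is answered in `v'` with an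
      -- empty left part.
      · rcases s with _ | ⟨b, s⟩
        · simp only [List.nil_append, List.append_nil] at hs hs'
          obtain ⟨s', y', hs', h1, h2⟩ := wordType_split hv (u := []) hs'.symm
          refine ⟨u' ++ s', y', by simp [hs'], ?_, h2⟩
          have := ih (wordType_of_succ hu) h1
          rwa [List.append_nil, hs] at this
        · simp only [List.cons_append, List.cons.injEq] at hs'
          obtain ⟨rfl, rfl⟩ := hs'
          obtain ⟨x', s', hs', h1, h2⟩ := wordType_split hu hs
          exact ⟨x', s' ++ v', by simp [hs'], h1, ih h2 (wordType_of_succ hv)⟩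
    exact wordType_succ_eq (key hu hv) (key hu.symm hv.symm)

theorem wordType_map (g : α → β) {q : ℕ} {w w' : List α} (h : wordType q w = wordType q w') :
    wordType q (w.map g) = wordType q (w'.map g) := by
  induction q generalizing w w' with
  | zero => rfl
  | succ q ih =>
    have key : ∀ {w w' : List α}, wordType (q + 1) w = wordType (q + 1) w' →
        ∀ u a v, w.map g = u ++ a :: v → ∃ u' v', w'.map g = u' ++ a :: v' ∧
          wordType q u = wordType q u' ∧ wordType q v = wordType q v' := by
      intro w w' h u a v hw
      obtain ⟨u₀, s, rfl, rfl, hs⟩ := List.map_eq_append_iff.1 hw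
      obtain ⟨a₀, v₀, rfl, rfl, rfl⟩ := List.map_eq_cons_iff.1 hs
      obtain ⟨u', v', rfl, h1, h2⟩ := wordType_split h rfl
      exact ⟨u'.map g, v'.map g, by simp, ih h1, ih h2⟩
    exact wordType_succ_eq (key h) (key h.symm)

/-- The `n`-fold repetition of a word. -/
def wordPow (w : List α) (n : ℕ) : List α := (List.replicate n w).flatten

theorem wordPow_succ (w : List α) (n : ℕ) : wordPow w (n + 1) = w ++ wordPow w n := by
  simp [wordPow, List.replicate_succ]

theorem wordPow_add (w : List α) (m n : ℕ) : wordPow w (m + n) = wordPow w m ++ wordPow w n := by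
  simp [wordPow, ← List.replicate_append_replicate]

theorem wordPow_split {w : List α} {n : ℕ} {u : List α} {a : α} {v : List α}
    (h : wordPow w n = u ++ a :: v) : ∃ i j x y, n = i + j + 1 ∧ w = x ++ a :: y ∧
      u = wordPow w i ++ x ∧ v = y ++ wordPow w j := by
  induction n generalizing u with
  | zero => simp [wordPow] at h
  | succ n ih =>
    rw [wordPow_succ] at h
    have hc : ∀ s, u = w ++ s → wordPow w n = s ++ a :: v → ∃ i j x y, n + 1 = i + j + 1 ∧
        w = x ++ a :: y ∧ u = wordPow w i ++ x ∧ v = y ++ wordPow w j := by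
      rintro s rfl hs
      obtain ⟨i, j, x, y, rfl, h1, rfl, h3⟩ := ih hs
      exact ⟨i + 1, j, x, y, by ring, h1, by simp [wordPow_succ], h3⟩
    rcases List.append_eq_append_iff.1 h with ⟨s, hs, hs'⟩ | ⟨s, hs, hs'⟩
    · exact hc s hs hs'
    · rcases s with _ | ⟨b, s⟩
      · exact hc [] (by simpa using hs.symm) (by simpa using hs'.symm)
      · simp only [List.cons_append, List.cons.injEq] at hs'
        obtain ⟨rfl, rfl⟩ := hs'
        exact ⟨0, n, u, s, by ring, hs, by simp [wordPow], rfl⟩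

/-- This is the source of aperiodicity. A chosen letter leaves `i` copies of `w` to its left and `j`
to its right. A count of at least `2 ^ q - 1` may be answered by any other such count, a smaller one
is copied exactly; since `2 ^ (q + 1) - 1 = 2 * (2 ^ q - 1) + 1`, there is always room. -/
theorem wordType_wordPow (w : List α) {q m n : ℕ} (hm : 2 ^ q ≤ m + 1) (hn : 2 ^ q ≤ n + 1) :
    wordType q (wordPow w m) = wordType q (wordPow w n) := by
  induction q generalizing m n with
  | zero => rfl
  | succ q ih =>
    have key : ∀ {m n : ℕ}, 2 ^ (q + 1) ≤ m + 1 → 2 ^ (q + 1) ≤ n + 1 → ∀ u a v,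
        wordPow w m = u ++ a :: v → ∃ u' v', wordPow w n = u' ++ a :: v' ∧
          wordType q u = wordType q u' ∧ wordType q v = wordType q v' := by
      intro m n hm hn u a v h
      obtain ⟨i, j, x, y, rfl, hw, rfl, rfl⟩ := wordPow_split h
      obtain ⟨i', j', rfl, hi, hj⟩ : ∃ i' j', n = i' + j' + 1 ∧
          (i = i' ∨ 2 ^ q ≤ i + 1 ∧ 2 ^ q ≤ i' + 1) ∧
          (j = j' ∨ 2 ^ q ≤ j + 1 ∧ 2 ^ q ≤ j' + 1) := by
        have := Nat.one_le_two_pow (n := q)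
        rw [pow_succ] at hm hn
        rcases lt_or_ge (i + 1) (2 ^ q) with hi | hi
        · exact ⟨i, n - 1 - i, by omega, Or.inl rfl, Or.inr (by omega)⟩
        · rcases lt_or_ge (j + 1) (2 ^ q) with hj | hj
          · exact ⟨n - 1 - j, j, by omega, Or.inr (by omega), Or.inl rfl⟩
          · exact ⟨2 ^ q - 1, n - 2 ^ q, by omega, Or.inr (by omega), Or.inr (by omega)⟩
      have hpow : ∀ {i i' : ℕ}, (i = i' ∨ 2 ^ q ≤ i + 1 ∧ 2 ^ q ≤ i' + 1) →
          wordType q (wordPow w i) = wordType q (wordPow w i') := by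
        rintro i i' (rfl | ⟨h1, h2⟩)
        · rfl
        · exact ih h1 h2
      refine ⟨wordPow w i' ++ x, y ++ wordPow w j', ?_, wordType_append (hpow hi) rfl,
        wordType_append rfl (hpow hj)⟩
      rw [show i' + j' + 1 = i' + (1 + j') by ring, wordPow_add, wordPow_add]
      conv_lhs => rw [show wordPow w 1 = x ++ a :: y by simp [wordPow, ← hw]]
      simp
    exact wordType_succ_eq (key hm hn) (key hn hm)

theorem exists_mem_iff_of_wordType {q : ℕ} {w w' : List α}
    (h : wordType (q + 1) w = wordType (q + 1) w') (P : α → Prop) :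
    (∃ a ∈ w, P a) ↔ ∃ a ∈ w', P a := by
  have key : ∀ {w w' : List α}, wordType (q + 1) w = wordType (q + 1) w' →
      (∃ a ∈ w, P a) → ∃ a ∈ w', P a := by
    rintro w w' h ⟨a, ha, hP⟩
    obtain ⟨u, v, hw⟩ := List.append_of_mem ha
    obtain ⟨u', v', rfl, -⟩ := wordType_split h hw
    exact ⟨a, by simp, hP⟩
  exact ⟨key h, key h.symm⟩

theorem exists_pair_iff_of_wordType {q : ℕ} {w w' : List α}
    (h : wordType (q + 2) w = wordType (q + 2) w') (P Q : α → Prop) :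
    (∃ u b v, w = u ++ b :: v ∧ Q b ∧ ∃ a ∈ u, P a) ↔
      ∃ u b v, w' = u ++ b :: v ∧ Q b ∧ ∃ a ∈ u, P a := by
  have key : ∀ {w w' : List α}, wordType (q + 2) w = wordType (q + 2) w' →
      (∃ u b v, w = u ++ b :: v ∧ Q b ∧ ∃ a ∈ u, P a) →
      ∃ u b v, w' = u ++ b :: v ∧ Q b ∧ ∃ a ∈ u, P a := by
    rintro w w' h ⟨u, b, v, hw, hb, hu⟩
    obtain ⟨u', v', rfl, h1, -⟩ := wordType_split h hw
    exact ⟨u', b, v', rfl, hb, (exists_mem_iff_of_wordType h1 P).1 hu⟩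
  exact ⟨key h, key h.symm⟩

end WordType

/-! ### Truth of formulas depends only on types -/

/-- The cycle with a unary predicate and a tuple of elements, as a word in which every letter
records membership in the predicate and the entries of the tuple at that position. -/
def marked {n m : ℕ} (U : Set (Fin n)) (x : Fin m → Fin n) : List (Prop × (Fin m → Prop)) :=
  List.ofFn fun s => (s ∈ U, fun i => x i = s)

theorem mem_marked {n m : ℕ} {U : Set (Fin n)} {x : Fin m → Fin n}
    {P : Prop × (Fin m → Prop) → Prop} :
    (∃ a ∈ marked U x, P a) ↔ ∃ s, P (s ∈ U, fun i => x i = s) := by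
  simp [marked, List.mem_ofFn]

theorem ofFn_eq_append_cons {α : Type*} {n : ℕ} {f : Fin n → α} {u v : List α} {a : α} :
    List.ofFn f = u ++ a :: v ↔ ∃ t : Fin n, u = (List.ofFn f).take t ∧ a = f t ∧
      v = (List.ofFn f).drop (t + 1) := by
  constructor
  · intro h
    have hl := congrArg List.length h
    simp only [List.length_ofFn, List.length_append, List.length_cons] at hl
    refine ⟨⟨u.length, by omega⟩, ?_, ?_, ?_⟩
    · simp [h]
    · have : (List.ofFn f)[u.length]'(by simp; omega) = (u ++ a :: v)[u.length]'(by simp) := by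
        simp only [h]
      simpa using this.symm
    · simp [h]
  · rintro ⟨t, rfl, rfl, rfl⟩
    have := List.take_append_drop t (List.ofFn f)
    conv_lhs => rw [← this]
    rw [List.drop_eq_getElem_cons (by simp)]
    simp

/-- Cutting at the position marked `j` and looking for the mark `i` on its left expresses the order
within rank two. -/
theorem lt_iff_marked {n m : ℕ} {U : Set (Fin n)} {x : Fin m → Fin n} {i j : Fin m} :
    x i < x j ↔ ∃ u b v, marked U x = u ++ b :: v ∧ b.2 j ∧ ∃ a ∈ u, a.2 i := by
  constructor
  · intro h
    refine ⟨_, _, _, ofFn_eq_append_cons.2 ⟨x j, rfl, rfl, rfl⟩, rfl, (x i ∈ U, fun l => x l = x i),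
      ?_, rfl⟩
    rw [List.mem_iff_getElem]
    exact ⟨x i, by simpa using h, by simp⟩
  · rintro ⟨u, b, v, h, hb, a, ha, hi⟩
    obtain ⟨t, rfl, rfl, rfl⟩ := ofFn_eq_append_cons.1 h
    obtain ⟨s, hs, rfl⟩ := List.mem_iff_getElem.1 ha
    simp only [List.getElem_take, List.getElem_ofFn] at hi hb
    rw [hi, hb]
    simp only [List.length_take, List.length_ofFn] at hs
    exact Fin.mk_lt_of_lt_val (by omega)

/-- Add to a letter the information whether the new entry of the tuple is there. -/
def addMark {m : ℕ} (b : Prop) (a : Prop × (Fin m → Prop)) : Prop × (Fin (m + 1) → Prop) :=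
  (a.1, Fin.snoc (α := fun _ => Prop) a.2 b)

theorem marked_snoc {n m : ℕ} (U : Set (Fin n)) (x : Fin m → Fin n) (t : Fin n) :
    marked U (Fin.snoc x t : Fin (m + 1) → Fin n) =
      ((marked U x).take t).map (addMark False) ++ addMark True (t ∈ U, fun i => x i = t) ::
        ((marked U x).drop (t + 1)).map (addMark False) := by
  have hmark : ∀ s : Fin n, ((s ∈ U, fun i => (Fin.snoc x t : Fin (m + 1) → Fin n) i = s) :
      Prop × (Fin (m + 1) → Prop)) = addMark (t = s) (s ∈ U, fun i => x i = s) := by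
    intro s
    refine Prod.ext rfl (funext fun i => ?_)
    refine Fin.lastCases ?_ (fun i => ?_) i <;> simp [addMark]
  refine List.ext_getElem ?_ fun k h1 h2 => ?_
  · simp [marked]; omega
  · simp only [marked, List.getElem_ofFn, hmark]
    simp only [marked, List.length_ofFn] at h1
    rw [List.getElem_append]
    simp only [List.length_map, List.length_take, List.length_ofFn, List.getElem_map,
      List.getElem_take, List.getElem_ofFn, List.getElem_cons, List.getElem_drop]
    split_ifs with h3 h4
    · congr 1; simp [Fin.ext_iff]; omega
    · have : t = ⟨k, h1⟩ := Fin.ext (by simp; omega)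
      subst this; simp
    · have h5 : (t : ℕ) + 1 + (k - min (t : ℕ) n - 1) = k := by omega
      simp only [h5]
      congr 1; simp [Fin.ext_iff]; omega

/-- One round of the game: the two words are cut at `t` and at its answer, and recording the new
entry changes letters one by one, which preserves the types of the pieces. -/
theorem wordType_marked_snoc {q n n' m : ℕ} {U : Set (Fin n)} {U' : Set (Fin n')}
    {x : Fin m → Fin n} {x' : Fin m → Fin n'}
    (h : wordType (q + 1) (marked U x) = wordType (q + 1) (marked U' x')) (t : Fin n) :
    ∃ t' : Fin n', wordType q (marked U (Fin.snoc x t : Fin (m + 1) → Fin n)) =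
      wordType q (marked U' (Fin.snoc x' t' : Fin (m + 1) → Fin n')) := by
  obtain ⟨u', v', h1, h2, h3⟩ := wordType_split h (ofFn_eq_append_cons.2 ⟨t, rfl, rfl, rfl⟩)
  obtain ⟨t', rfl, h5, rfl⟩ := ofFn_eq_append_cons.1 h1
  refine ⟨t', ?_⟩
  rw [marked_snoc, marked_snoc, ← h5]
  refine wordType_append (wordType_map _ h2) ?_
  exact wordType_append (u := [_]) (u' := [_]) rfl (wordType_map _ h3)

theorem term_eq_var {m : ℕ} (t : circular.Term (Empty ⊕ Fin m)) :
    ∃ i, t = FirstOrder.Language.Term.var (Sum.inr i) := by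
  rcases t with (i | i) | f
  · exact i.elim
  · exact ⟨i, rfl⟩
  · exact Empty.elim f

/-- Atomic formulas need rank one or two, and every quantifier costs one more. -/
theorem realize_iff_of_wordType {m : ℕ} (φ : circular.BoundedFormula Empty m) :
    ∃ q, ∀ (n n' : ℕ) (U : Set (Fin n)) (U' : Set (Fin n')) (x : Fin m → Fin n)
      (x' : Fin m → Fin n') (e : Empty → Fin n) (e' : Empty → Fin n'),
      wordType q (marked U x) = wordType q (marked U' x') →
      ((letI := model n U; φ.Realize e x) ↔ (letI := model n' U'; φ.Realize e' x')) := by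
  induction φ with
  | falsum => exact ⟨0, fun _ _ _ _ _ _ _ _ _ => Iff.rfl⟩
  | equal t₁ t₂ =>
    obtain ⟨i, rfl⟩ := term_eq_var t₁
    obtain ⟨j, rfl⟩ := term_eq_var t₂
    refine ⟨1, fun n n' U U' x x' e e' h => ?_⟩
    have h1 := exists_mem_iff_of_wordType h (fun a => a.2 i ∧ a.2 j)
    rw [mem_marked, mem_marked] at h1
    simpa [FirstOrder.Language.BoundedFormula.Realize, eq_comm] using h1
  | @rel m l R ts =>
    choose i hi using fun k => term_eq_var (ts k)
    obtain rfl : ts = fun k => FirstOrder.Language.Term.var (Sum.inr (i k)) := funext hi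
    cases R with
    | U =>
      refine ⟨1, fun n n' U U' x x' e e' h => ?_⟩
      have h1 := exists_mem_iff_of_wordType h (fun a => a.1 ∧ a.2 (i 0))
      rw [mem_marked, mem_marked] at h1
      have h2 : ∀ {n} (U : Set (Fin n)) (x : Fin m → Fin n),
          (∃ s, s ∈ U ∧ x (i 0) = s) ↔ x (i 0) ∈ U := by simp
      rw [h2, h2] at h1
      exact h1
    | C =>
      refine ⟨2, fun n n' U U' x x' e e' h => ?_⟩
      have hlt : ∀ k l, x k < x l ↔ x' k < x' l := fun k l => by
        rw [lt_iff_marked (U := U), lt_iff_marked (U := U')]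
        exact exists_pair_iff_of_wordType h (fun a => a.2 k) (fun a => a.2 l)
      change Clockwise (x (i 0)) (x (i 1)) (x (i 2)) ↔ Clockwise (x' (i 0)) (x' (i 1)) (x' (i 2))
      simp only [Clockwise, hlt]
  | imp φ ψ ihφ ihψ =>
    obtain ⟨q, hq⟩ := ihφ
    obtain ⟨r, hr⟩ := ihψ
    refine ⟨max q r, fun n n' U U' x x' e e' h => ?_⟩
    exact imp_congr (hq n n' U U' x x' e e' (wordType_of_le (le_max_left _ _) h))
      (hr n n' U U' x x' e e' (wordType_of_le (le_max_right _ _) h))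
  | all φ ih =>
    obtain ⟨q, hq⟩ := ih
    refine ⟨q + 1, fun n n' U U' x x' e e' h => ?_⟩
    constructor
    · intro h1 t'
      obtain ⟨t, ht⟩ := wordType_marked_snoc h.symm t'
      exact (hq _ _ _ _ _ _ e e' ht.symm).1 (h1 t)
    · intro h1 t
      obtain ⟨t', ht⟩ := wordType_marked_snoc h t
      exact (hq _ _ _ _ _ _ e e' ht).2 (h1 t')

/-- The subset of `Fin w.length` of the positions of a word at which the letter is `true`. -/
def wordSet (w : List Bool) : Set (Fin w.length) := {i | w.get i = true}

theorem exists_rank (S : circular.Sentence) : ∃ q, ∀ w w' : List Bool,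
    wordType q w = wordType q w' →
      (Holds w.length (wordSet w) S ↔ Holds w'.length (wordSet w') S) := by
  obtain ⟨q, hq⟩ := realize_iff_of_wordType S
  refine ⟨q, fun w w' h => hq _ _ _ _ _ _ _ _ ?_⟩
  have key : ∀ w : List Bool, marked (wordSet w) (default : Fin 0 → Fin w.length) =
      w.map fun b => (b = true, fun i => i.elim0) := by
    intro w
    refine List.ext_getElem (by simp [marked]) fun k h1 h2 => ?_
    simp only [marked, List.getElem_ofFn, List.getElem_map]
    exact Prod.ext rfl (funext fun i => i.elim0)
  rw [key, key]
  exact wordType_map _ h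

theorem holds_equiv {n n' : ℕ} {U : Set (Fin n)} {U' : Set (Fin n')} (σ : Fin n ≃ Fin n')
    (hU : ∀ i, σ i ∈ U' ↔ i ∈ U)
    (hC : ∀ x y z, Clockwise (σ x) (σ y) (σ z) ↔ Clockwise x y z) (S : circular.Sentence) :
    Holds n U S ↔ Holds n' U' S := by
  let _ := model n U
  let _ := model n' U'
  refine FirstOrder.Language.StrongHomClass.realize_sentence
    (⟨σ, fun f => f.elim, ?_⟩ : circular.Equiv (Fin n) (Fin n')) S
  intro k R x
  cases R with
  | U => exact hU _
  | C => exact hC _ _ _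

/-- The clockwise relation is invariant under the rotation exchanging the two factors. Without this
symmetry the first letter of the word could be described, and the zero-one law would fail. -/
theorem holds_append_comm (u v : List Bool) (S : circular.Sentence) :
    Holds (u ++ v).length (wordSet (u ++ v)) S ↔ Holds (v ++ u).length (wordSet (v ++ u)) S := by
  have h1 : (u ++ v).length = u.length + v.length := List.length_append
  have h2 : (v ++ u).length = v.length + u.length := List.length_append
  refine holds_equiv ⟨fun i => ⟨if (i : ℕ) < u.length then i + v.length else i - u.length, ?_⟩,
    fun i => ⟨if (i : ℕ) < v.length then i + u.length else i - v.length, ?_⟩, ?_, ?_⟩ ?_ ?_ S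
  · have := i.2; split_ifs <;> omega
  · have := i.2; split_ifs <;> omega
  · intro i; have := i.2; simp only [Fin.ext_iff]; split_ifs <;> omega
  · intro i; have := i.2; simp only [Fin.ext_iff]; split_ifs <;> omega
  · intro i
    have := i.2
    simp only [wordSet, Set.mem_ofPred_eq, Equiv.coe_fn_mk, List.get_eq_getElem]
    split_ifs with h
    · rw [List.getElem_append_right (by omega), List.getElem_append_left (by omega)]
      simp
    · rw [List.getElem_append_left (by omega), List.getElem_append_right (by omega)]
  · intro x y z
    have := x.2; have := y.2; have := z.2
    simp only [Clockwise, Equiv.coe_fn_mk, Fin.lt_def]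
    split_ifs <;> omega

/-! ### Random words -/

/-- The expectation of `g` at a random word of length `n` whose letters are independently `true`
with probability `p`. -/
noncomputable def expect (p : ℝ) : ℕ → (List Bool → ℝ) → ℝ
  | 0, g => g []
  | n + 1, g => p * expect p n (fun w => g (true :: w)) +
      (1 - p) * expect p n (fun w => g (false :: w))

open Classical in
/-- The probability that a random word of length `n` satisfies `A`. -/
noncomputable def pr (p : ℝ) (n : ℕ) (A : List Bool → Prop) : ℝ :=
  expect p n fun w => if A w then 1 else 0

section Expect

variable {p : ℝ}

theorem expect_const (p : ℝ) (n : ℕ) (c : ℝ) : expect p n (fun _ => c) = c := by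
  induction n with
  | zero => rfl
  | succ n ih => simp only [expect, ih]; ring

theorem expect_add (p : ℝ) (n : ℕ) (g h : List Bool → ℝ) :
    expect p n (fun w => g w + h w) = expect p n g + expect p n h := by
  induction n generalizing g h with
  | zero => rfl
  | succ n ih => simp only [expect, ih]; ring

theorem expect_mul (p : ℝ) (n : ℕ) (c : ℝ) (g : List Bool → ℝ) :
    expect p n (fun w => c * g w) = c * expect p n g := by
  induction n generalizing g with
  | zero => rfl
  | succ n ih => simp only [expect, ih]; ring

theorem expect_mono (h0 : 0 ≤ p) (h1 : p ≤ 1) {n : ℕ} {g h : List Bool → ℝ}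
    (hgh : ∀ w, w.length = n → g w ≤ h w) : expect p n g ≤ expect p n h := by
  induction n generalizing g h with
  | zero => exact hgh [] rfl
  | succ n ih =>
    exact add_le_add
      (mul_le_mul_of_nonneg_left (ih fun w hw => hgh _ (by simp [hw])) h0)
      (mul_le_mul_of_nonneg_left (ih fun w hw => hgh _ (by simp [hw])) (sub_nonneg.2 h1))

theorem expect_append (p : ℝ) (m n : ℕ) (g : List Bool → ℝ) :
    expect p (m + n) g = expect p m fun u => expect p n fun v => g (u ++ v) := by
  induction m generalizing g with
  | zero => simp [expect]
  | succ m ih => rw [Nat.succ_add]; simp only [expect, ih, List.cons_append]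

theorem expect_comm (p : ℝ) (m n : ℕ) (g : List Bool → List Bool → ℝ) :
    (expect p m fun u => expect p n fun v => g u v) =
      expect p n fun v => expect p m fun u => g u v := by
  induction m generalizing g with
  | zero => rfl
  | succ m ih => simp only [expect, ih, expect_add, expect_mul]

theorem expect_sum {ι : Type*} (s : Finset ι) (p : ℝ) (n : ℕ) (g : ι → List Bool → ℝ) :
    expect p n (fun w => ∑ i ∈ s, g i w) = ∑ i ∈ s, expect p n (g i) := by
  classical
  induction s using Finset.induction_on with
  | empty => simp [expect_const]
  | insert i s hi ih => simp only [Finset.sum_insert hi, expect_add, ih]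

theorem pr_succ (p : ℝ) (n : ℕ) (A : List Bool → Prop) : pr p (n + 1) A =
    p * pr p n (fun w => A (true :: w)) + (1 - p) * pr p n (fun w => A (false :: w)) := rfl

theorem pr_mono (h0 : 0 ≤ p) (h1 : p ≤ 1) {n : ℕ} {A B : List Bool → Prop}
    (h : ∀ w, w.length = n → A w → B w) : pr p n A ≤ pr p n B := by
  refine expect_mono h0 h1 fun w hw => ?_
  have := h w hw
  split_ifs <;> first | (exfalso; tauto) | norm_num

theorem pr_congr (h0 : 0 ≤ p) (h1 : p ≤ 1) {n : ℕ} {A B : List Bool → Prop}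
    (h : ∀ w, w.length = n → (A w ↔ B w)) : pr p n A = pr p n B :=
  le_antisymm (pr_mono h0 h1 fun w hw => (h w hw).1) (pr_mono h0 h1 fun w hw => (h w hw).2)

theorem pr_true (p : ℝ) (n : ℕ) : pr p n (fun _ => True) = 1 := by
  simp [pr, expect_const]

theorem pr_nonneg (h0 : 0 ≤ p) (h1 : p ≤ 1) (n : ℕ) (A : List Bool → Prop) : 0 ≤ pr p n A := by
  rw [← expect_const p n 0]
  exact expect_mono h0 h1 fun w _ => by split_ifs <;> norm_num

theorem pr_le_one (h0 : 0 ≤ p) (h1 : p ≤ 1) (n : ℕ) (A : List Bool → Prop) : pr p n A ≤ 1 := by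
  rw [← pr_true p n]
  exact pr_mono h0 h1 fun _ _ _ => trivial

theorem pr_not (p : ℝ) (n : ℕ) (A : List Bool → Prop) :
    pr p n (fun w => ¬ A w) = 1 - pr p n A := by
  rw [eq_sub_iff_add_eq, pr, pr, ← expect_add]
  conv_rhs => rw [← expect_const p n 1]
  congr 1; funext w
  split_ifs <;> norm_num

theorem pr_or_le (h0 : 0 ≤ p) (h1 : p ≤ 1) (n : ℕ) (A B : List Bool → Prop) :
    pr p n (fun w => A w ∨ B w) ≤ pr p n A + pr p n B := by
  rw [pr, pr, pr, ← expect_add]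
  refine expect_mono h0 h1 fun w _ => ?_
  split_ifs <;> first | (exfalso; tauto) | norm_num

theorem pr_add_le (h0 : 0 ≤ p) (h1 : p ≤ 1) {n : ℕ} {A B C : List Bool → Prop}
    (h : ∀ w, w.length = n → (A w → C w) ∧ (B w → C w) ∧ (A w → ¬ B w)) :
    pr p n A + pr p n B ≤ pr p n C := by
  rw [pr, pr, pr, ← expect_add]
  refine expect_mono h0 h1 fun w hw => ?_
  have := h w hw
  split_ifs <;> first | (exfalso; tauto) | norm_num

theorem pr_exists_le {ι : Type*} (h0 : 0 ≤ p) (h1 : p ≤ 1) (s : Finset ι) (n : ℕ)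
    (A : ι → List Bool → Prop) :
    pr p n (fun w => ∃ i ∈ s, A i w) ≤ ∑ i ∈ s, pr p n (A i) := by
  simp only [pr]
  rw [← expect_sum]
  refine expect_mono h0 h1 fun w _ => ?_
  split_ifs with h
  · obtain ⟨i, hi, hA⟩ := h
    refine le_trans ?_ (Finset.single_le_sum (fun j _ => ?_) hi)
    · simp [hA]
    · positivity
  · positivity

theorem expect_expect_mul (p : ℝ) (m n : ℕ) (g h : List Bool → ℝ) :
    (expect p m fun u => expect p n fun v => g u * h v) = expect p m g * expect p n h := by
  simp only [expect_mul]
  rw [mul_comm, ← expect_mul]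
  simp only [mul_comm]

theorem pr_append_le (h0 : 0 ≤ p) (h1 : p ≤ 1) {m n : ℕ} {A B C : List Bool → Prop}
    (h : ∀ u v, u.length = m → v.length = n → A (u ++ v) → B u ∧ C v) :
    pr p (m + n) A ≤ pr p m B * pr p n C := by
  rw [pr, pr, pr, expect_append, ← expect_expect_mul]
  refine expect_mono h0 h1 fun u hu => expect_mono h0 h1 fun v hv => ?_
  have := h u v hu hv
  split_ifs <;> first | (exfalso; tauto) | norm_num

theorem le_pr_append (h0 : 0 ≤ p) (h1 : p ≤ 1) {m n : ℕ} {A B C : List Bool → Prop}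
    (h : ∀ u v, u.length = m → v.length = n → B u → C v → A (u ++ v)) :
    pr p m B * pr p n C ≤ pr p (m + n) A := by
  rw [pr, pr, pr, expect_append, ← expect_expect_mul]
  refine expect_mono h0 h1 fun u hu => expect_mono h0 h1 fun v hv => ?_
  have := h u v hu hv
  split_ifs <;> first | (exfalso; tauto) | norm_num

/-- A union bound over the two parts of a random word and their two concatenations. -/
theorem pr_le_of_append (h0 : 0 ≤ p) (h1 : p ≤ 1) {m n : ℕ} {A B : List Bool → Prop}
    (h : ∀ u v, u.length = m → v.length = n → A (u ++ v) →
      B u ∨ B v ∨ B (u ++ v) ∨ B (v ++ u)) :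
    pr p (m + n) A ≤ pr p m B + pr p n B + pr p (m + n) B + pr p (m + n) B := by
  classical
  have e1 : (expect p m fun u => expect p n fun _ => if B u then (1 : ℝ) else 0) = pr p m B := by
    simp only [expect_const, pr]
  have e2 : (expect p m fun _ => expect p n fun v => if B v then (1 : ℝ) else 0) = pr p n B := by
    simp only [expect_const, pr]
  have e3 : (expect p m fun u => expect p n fun v => if B (u ++ v) then (1 : ℝ) else 0) =
      pr p (m + n) B := by rw [pr, expect_append]
  have e4 : (expect p m fun u => expect p n fun v => if B (v ++ u) then (1 : ℝ) else 0) =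
      pr p (m + n) B := by rw [expect_comm, pr, add_comm m n, expect_append]
  calc pr p (m + n) A = expect p m fun u => expect p n fun v => if A (u ++ v) then 1 else 0 := by
        rw [pr, expect_append]
    _ ≤ expect p m fun u => expect p n fun v => (if B u then (1 : ℝ) else 0) +
        (if B v then 1 else 0) + (if B (u ++ v) then 1 else 0) + (if B (v ++ u) then 1 else 0) := by
        refine expect_mono h0 h1 fun u hu => expect_mono h0 h1 fun v hv => ?_
        have := h u v hu hv
        split_ifs <;> first | (exfalso; tauto) | norm_num
    _ = _ := by simp only [expect_add, e1, e2, e3, e4]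

theorem expect_eq_sum (p : ℝ) (n : ℕ) (g : List Bool → ℝ) :
    expect p n g = ∑ b : Fin n → Bool, (∏ i, if b i then p else 1 - p) * g (List.ofFn b) := by
  induction n generalizing g with
  | zero => simp [expect]
  | succ n ih =>
    rw [← (Fin.consEquiv fun _ : Fin (n + 1) => Bool).sum_comp, Fintype.sum_prod_type]
    simp [expect, ih, Fin.consEquiv, Fin.prod_univ_succ, List.ofFn_succ, Finset.mul_sum, mul_assoc]

end Expect

theorem holds_ofFn {n : ℕ} (b : Fin n → Bool) (S : circular.Sentence) :
    Holds (List.ofFn b).length (wordSet (List.ofFn b)) S ↔ Holds n {i | b i = true} S := by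
  refine holds_equiv (finCongr (by simp)) ?_ ?_ S
  · intro i
    simp only [wordSet, Set.mem_ofPred_eq, List.get_eq_getElem, List.getElem_ofFn]
    exact Iff.rfl
  · exact fun x y z => Iff.rfl

/-- Both sides weight a set with `a` elements by `p ^ a * (1 - p) ^ (n - a)`. -/
theorem prob_eq_pr (n : ℕ) (p : unitInterval) (S : circular.Sentence) :
    prob n p S = pr p n fun w => Holds w.length (wordSet w) S := by
  classical
  rw [pr, expect_eq_sum, prob]
  have h1 : (ProbabilityTheory.setBernoulli (Set.univ : Set (Fin n)) p).real {U | Holds n U S} =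
      ∑ U : Set (Fin n), if Holds n U S then
        (ProbabilityTheory.setBernoulli (Set.univ : Set (Fin n)) p).real {U} else 0 := by
    rw [← Finset.sum_filter, MeasureTheory.sum_measureReal_singleton]
    simp
  rw [h1]
  let e : (Fin n → Bool) ≃ Set (Fin n) :=
    ⟨fun b => {i | b i = true}, fun U i => decide (i ∈ U), fun b => by simp, fun U => by simp⟩
  rw [← e.sum_comp]
  refine Finset.sum_congr rfl fun b _ => ?_
  rw [ProbabilityTheory.setBernoulli_real_singleton p (Set.subset_univ _) Set.finite_univ]
  simp only [holds_ofFn, mul_ite, mul_one, mul_zero, Finset.prod_ite, Finset.prod_const]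
  congr 2
  · rw [← Set.ncard_coe_finset]
    simp [e]
  · rw [← Set.ncard_coe_finset]
    congr 2
    ext i
    simp [e]

/-! ### Ideals and idempotents in aperiodic monoids -/

section Aperiodic

variable {M : Type*} [Monoid M] {N : ℕ}

/-- The hypotheses give `a ^ n * e * b ^ n = e` for all `n`; at `n = N` one further factor `a` on
the left is absorbed. -/
theorem mul_eq_of_aperiodic (hN : ∀ x : M, x ^ (N + 1) = x ^ N) {a b e : M}
    (hab : a * b = e) (hb : e * b = b) : a * e = e := by
  have h : ∀ n : ℕ, a ^ n * e * b ^ n = e := by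
    intro n
    induction n with
    | zero => simp
    | succ n ih =>
      calc a ^ (n + 1) * e * b ^ (n + 1) = a ^ n * (a * (e * b)) * b ^ n := by
            rw [pow_succ, pow_succ']; simp only [mul_assoc]
        _ = e := by rw [hb, hab, ih]
  calc a * e = a * (a ^ N * e * b ^ N) := by rw [h]
    _ = a ^ (N + 1) * e * b ^ N := by rw [pow_succ']; simp only [mul_assoc]
    _ = e := by rw [hN, h]

theorem mul_eq_of_aperiodic' (hN : ∀ x : M, x ^ (N + 1) = x ^ N) {a b e : M}
    (hab : a * b = e) (ha : a * e = a) : e * b = e := by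
  have h : ∀ n : ℕ, a ^ n * e * b ^ n = e := by
    intro n
    induction n with
    | zero => simp
    | succ n ih =>
      calc a ^ (n + 1) * e * b ^ (n + 1) = a ^ n * ((a * e) * b) * b ^ n := by
            rw [pow_succ, pow_succ']; simp only [mul_assoc]
        _ = e := by rw [ha, hab, ih]
  calc e * b = a ^ N * e * b ^ N * b := by rw [h]
    _ = a ^ N * e * b ^ (N + 1) := by rw [pow_succ b]; simp only [mul_assoc]
    _ = e := by rw [hN, h]

/-- In an aperiodic monoid, an element of the local monoid at an idempotent `e` that generates the
same two-sided ideal as `e` is equal to `e`. -/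
theorem eq_of_aperiodic (hN : ∀ x : M, x ^ (N + 1) = x ^ N) {e x : M} (he : e * e = e)
    (h1 : e * x = x) (h2 : x * e = x) {u v : M} (h : u * x * v = e) : x = e := by
  -- Replacing the multipliers by `e * u * e` and `e * v * e` moves everything into the local monoid
  -- at `e`, where the cancellation lemmas apply.
  have h3 : (e * u * e) * (x * (e * v * e)) = e := by
    calc (e * u * e) * (x * (e * v * e)) = e * (u * ((e * x) * e) * v) * e := by
          simp only [mul_assoc]
      _ = e := by rw [h1, h2, h, he, he]
  have h4 : e * (x * (e * v * e)) = x * (e * v * e) := by rw [← mul_assoc, h1]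
  have h5 : (e * u * e) * e = e := mul_eq_of_aperiodic hN h3 h4
  have h6 : (e * u * e) = e := by rwa [mul_assoc, he] at h5
  have h7 : x * (e * v * e) = e := by rwa [h6, h4] at h3
  have h8 := mul_eq_of_aperiodic' hN h7 h2
  rw [← mul_assoc, ← mul_assoc, he] at h8
  rw [h8, h2] at h7
  exact h7

/-- `y` lies in the two-sided ideal generated by `x`. -/
def InIdeal (x y : M) : Prop := ∃ a b, y = a * x * b

theorem InIdeal.refl (x : M) : InIdeal x x := ⟨1, 1, by simp⟩

theorem InIdeal.trans {x y z : M} (h1 : InIdeal x y) (h2 : InIdeal y z) : InIdeal x z := by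
  obtain ⟨a, b, rfl⟩ := h1
  obtain ⟨c, d, rfl⟩ := h2
  exact ⟨c * a, b * d, by simp only [mul_assoc]⟩

theorem InIdeal.mul {x y : M} (h : InIdeal x y) (a b : M) : InIdeal x (a * y * b) :=
  h.trans ⟨a, b, rfl⟩

theorem InIdeal.mul_left {x y : M} (h : InIdeal x y) (a : M) : InIdeal x (a * y) := by
  simpa using h.mul a 1

theorem InIdeal.mul_right {x y : M} (h : InIdeal x y) (b : M) : InIdeal x (y * b) := by
  simpa using h.mul 1 b

/-- Write `x = s * x * (y * t)` and iterate to get `x = s ^ N * x * (y * t) ^ N`; the power `(y * t)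
^ N` is idempotent. It contains a factor `y` only if `N ≠ 0`. -/
theorem exists_idempotent (hN : ∀ x : M, x ^ (N + 1) = x ^ N) {x y : M}
    (h : InIdeal (x * y) x) : ∃ e : M, e * e = e ∧ InIdeal e x ∧ (N ≠ 0 → InIdeal y e) := by
  obtain ⟨s, t, h⟩ := h
  have hx : x = s * x * (y * t) := by simpa only [mul_assoc] using h
  have hn : ∀ n : ℕ, s ^ n * x * (y * t) ^ n = x := by
    intro n
    induction n with
    | zero => simp
    | succ n ih =>
      calc s ^ (n + 1) * x * (y * t) ^ (n + 1) = s ^ n * (s * x * (y * t)) * (y * t) ^ n := by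
            rw [pow_succ, pow_succ']; simp only [mul_assoc]
        _ = x := by rw [← hx, ih]
  have hpow : ∀ (z : M) (n : ℕ), z ^ (N + n) = z ^ N := by
    intro z n
    induction n with
    | zero => rfl
    | succ n ih => rw [← add_assoc, pow_succ, ih, ← pow_succ, hN]
  refine ⟨(y * t) ^ N, by rw [← pow_add, hpow], ⟨s ^ N * x, 1, ?_⟩, fun hN0 => ?_⟩
  · rw [mul_one, hn]
  · obtain ⟨n, rfl⟩ := Nat.exists_eq_succ_of_ne_zero hN0
    exact ⟨1, t * (y * t) ^ n, by rw [pow_succ']; simp only [mul_assoc, one_mul]⟩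

/-- Two elements of a `𝒥`-class with idempotent `e` whose products in both orders stay in the
class are, up to a circular shift, equal to `e`. -/
theorem circular_eq_idempotent (hN : ∀ x : M, x ^ (N + 1) = x ^ N) {f : M → Prop}
    (hf : ∀ x y, f (x * y) ↔ f (y * x)) {e x y : M} (he : e * e = e) (hx : InIdeal e x)
    (hy : InIdeal e y) (hxy : InIdeal (x * y) e) (hyx : InIdeal (y * x) e) :
    f (x * y) ↔ f e := by
  obtain ⟨a, b, rfl⟩ := hx
  obtain ⟨c, d, rfl⟩ := hy
  -- The middle factor `e * b * c * e` lies in the local monoid at `e` and divides `e`, so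
  -- `eq_of_aperiodic` collapses it.
  have key : ∀ {z b c d : M}, InIdeal (z * e * b * (c * e * d)) e → e * b * c * e = e := by
    rintro z b c d ⟨u, v, h⟩
    refine eq_of_aperiodic hN he (u := u * z) (v := d * v) (by simp only [← mul_assoc, he])
      (by simp only [mul_assoc, he]) ?_
    refine Eq.trans ?_ h.symm
    simp only [mul_assoc]
  have h1 := key hxy
  have h2 := key hyx
  -- By `h1` the product reduces to `a * e * d`; rotated, this is `e * d * a * e`, which is `e` by
  -- `h2`.
  calc f (a * e * b * (c * e * d)) ↔ f ((a * e) * (e * b * c * e * d)) := by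
        rw [show (a * e) * (e * b * c * e * d) = a * (e * e) * b * (c * e * d) by
          simp only [mul_assoc], he]
    _ ↔ f (e * d * a * e) := by
        rw [h1, hf]; simp only [mul_assoc]
    _ ↔ f e := by rw [h2]

end Aperiodic

/-! ### Zero-one law from concentration on a `𝒥`-class -/

section ZeroOne

variable {M : Type*} [Monoid M] [Finite M] {N : ℕ} {φ : List Bool → M} {p : ℕ → ℝ}

/-- The lengths `m n` are comparable with `n`. -/
def Comparable (m : ℕ → ℕ) : Prop := ∀ᶠ n in atTop, m n ≤ n ∧ n ≤ 3 * m n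

/-- If every principal ideal of a finite aperiodic monoid is asymptotically either hit or avoided
by the values of random words, then circular properties of the value have a zero-one law. -/
theorem tendsto_zero_or_one_of_ideals (hN : ∀ x : M, x ^ (N + 1) = x ^ N) (hN0 : N ≠ 0)
    (hmul : ∀ u v, φ (u ++ v) = φ u * φ v) (hsurj : Function.Surjective φ)
    (h0 : ∀ n, 0 ≤ p n) (h1 : ∀ n, p n ≤ 1)
    (hI : ∀ x : M,
      (∀ m, Comparable m → Tendsto (fun n => pr (p n) (m n) fun w => InIdeal x (φ w))
        atTop (𝓝 1)) ∨
      (∀ m, Comparable m → Tendsto (fun n => pr (p n) (m n) fun w => InIdeal x (φ w))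
        atTop (𝓝 0)))
    {H : List Bool → Prop} (hH : ∀ u v, φ u = φ v → (H u ↔ H v))
    (hcirc : ∀ u v, H (u ++ v) ↔ H (v ++ u)) :
    Tendsto (fun n => pr (p n) n H) atTop (𝓝 0) ∨
      Tendsto (fun n => pr (p n) n H) atTop (𝓝 1) := by
  classical
  have := Fintype.ofFinite M
  have hcomp : Comparable (fun n => n) := Eventually.of_forall fun n => ⟨le_rfl, by dsimp only; omega⟩
  -- The factor `3` in `Comparable`, rather than `2`, absorbs the rounding in `n / 2`.
  have hcomp1 : Comparable (fun n => n / 2) := by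
    filter_upwards [eventually_ge_atTop 2] with n hn
    omega
  have hcomp2 : Comparable (fun n => n - n / 2) := by
    filter_upwards [eventually_ge_atTop 2] with n hn
    omega
  -- `L` holds the generators of the ideals hit with probability tending to one, and `x` generates
  -- one of least cardinality. Ideals strictly inside that of `x` are then avoided, so the value
  -- concentrates on the `𝒥`-class `D` of `x`.
  let L : Finset M := Finset.univ.filter fun x => ∀ m, Comparable m →
    Tendsto (fun n => pr (p n) (m n) fun w => InIdeal x (φ w)) atTop (𝓝 1)
  have hL : L.Nonempty := by
    refine ⟨1, Finset.mem_filter.2 ⟨Finset.mem_univ _, fun m _ => ?_⟩⟩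
    have : ∀ y : M, InIdeal 1 y := fun y => ⟨y, 1, by simp⟩
    simp only [this, pr_true]
    exact tendsto_const_nhds
  obtain ⟨x, hxL, hx⟩ := L.exists_min_image
    (fun x => (Finset.univ.filter fun y => InIdeal x y).card) hL
  have hxlim := (Finset.mem_filter.1 hxL).2
  have hsmall : ∀ y, InIdeal x y → ¬ InIdeal y x → ∀ m, Comparable m →
      Tendsto (fun n => pr (p n) (m n) fun w => InIdeal y (φ w)) atTop (𝓝 0) := by
    intro y hxy hyx
    refine (hI y).resolve_left fun hy => ?_
    have hle := hx y (Finset.mem_filter.2 ⟨Finset.mem_univ _, hy⟩)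
    refine absurd hle (not_le.2 (Finset.card_lt_card ?_))
    rw [Finset.ssubset_iff_of_subset]
    · exact ⟨x, by simpa using InIdeal.refl x, by simpa using hyx⟩
    · intro z hz
      simp only [Finset.mem_filter, Finset.mem_univ, true_and] at hz ⊢
      exact hxy.trans hz
  let D : M → Prop := fun y => InIdeal x y ∧ InIdeal y x
  have hD : ∀ m, Comparable m →
      Tendsto (fun n => pr (p n) (m n) fun w => ¬ D (φ w)) atTop (𝓝 0) := by
    intro m hm
    let s : Finset M := Finset.univ.filter fun y => InIdeal x y ∧ ¬ InIdeal y x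
    have hlim : Tendsto (fun n => (1 - pr (p n) (m n) fun w => InIdeal x (φ w)) +
        ∑ y ∈ s, pr (p n) (m n) fun w => InIdeal y (φ w)) atTop (𝓝 0) := by
      have h2 := tendsto_finsetSum s fun y hy => hsmall y
        (Finset.mem_filter.1 hy).2.1 (Finset.mem_filter.1 hy).2.2 m hm
      have h3 := (tendsto_const_nhds (x := (1 : ℝ))).sub (hxlim m hm)
      simpa using h3.add h2
    refine squeeze_zero (fun n => pr_nonneg (h0 n) (h1 n) _ _) (fun n => ?_) hlim
    rw [← pr_not]
    refine le_trans (pr_mono (h0 n) (h1 n) (B := fun w => ¬ InIdeal x (φ w) ∨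
      ∃ y ∈ s, InIdeal y (φ w)) fun w _ hw => ?_) ((pr_or_le (h0 n) (h1 n) _ _ _).trans
        (add_le_add_right (pr_exists_le (h0 n) (h1 n) s _ _) _))
    by_contra hc
    rw [not_or, not_not] at hc
    refine hw ⟨hc.1, ?_⟩
    by_contra hc'
    exact hc.2 ⟨φ w, Finset.mem_filter.2 ⟨Finset.mem_univ _, hc.1, hc'⟩, InIdeal.refl _⟩
  -- For the two halves of a random word, `u`, `v`, `u ++ v` and `v ++ u` all have values in `D`
  -- with probability tending to one; an event incompatible with this is negligible.
  have hbad : ∀ A : List Bool → Prop,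
      (∀ u v, D (φ u) → D (φ v) → D (φ (u ++ v)) → D (φ (v ++ u)) → ¬ A (u ++ v)) →
      Tendsto (fun n => pr (p n) n A) atTop (𝓝 0) := by
    intro A hA
    have hlim := (((hD _ hcomp1).add (hD _ hcomp2)).add (hD _ hcomp)).add (hD _ hcomp)
    simp only [add_zero] at hlim
    refine squeeze_zero (fun n => pr_nonneg (h0 n) (h1 n) _ _) (fun n => ?_) hlim
    have hn : n / 2 + (n - n / 2) = n := by omega
    have := pr_le_of_append (h0 n) (h1 n) (m := n / 2) (n := n - n / 2) (A := A)
      (B := fun w => ¬ D (φ w)) fun u v _ _ hw => by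
        by_contra hc
        simp only [not_or, not_not] at hc
        exact hA u v hc.1 hc.2.1 hc.2.2.1 hc.2.2.2 hw
    rwa [hn] at this
  -- If there were no such words, the sure event would be negligible. Their product staying in `D`
  -- provides the idempotent.
  obtain ⟨u, v, hu, hv, huv⟩ : ∃ u v, D (φ u) ∧ D (φ v) ∧ D (φ (u ++ v)) := by
    by_contra hc
    have := hbad (fun _ => True) fun u v hu hv huv _ => absurd ⟨u, v, hu, hv, huv⟩ hc
    simp only [pr_true] at this
    exact one_ne_zero (tendsto_nhds_unique tendsto_const_nhds this)
  rw [hmul] at huv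
  obtain ⟨e, he, heu, hve⟩ := exists_idempotent hN (huv.2.trans hu.1)
  have hxe : InIdeal x e := hv.1.trans (hve hN0)
  have hex : InIdeal e x := heu.trans hu.2
  obtain ⟨w₀, rfl⟩ := hsurj e
  have key : ∀ u v, D (φ u) → D (φ v) → D (φ (u ++ v)) → D (φ (v ++ u)) →
      (H (u ++ v) ↔ H w₀) := by
    intro u v hu hv huv hvu
    have hf : ∀ w, (∃ w', φ w' = φ w ∧ H w') ↔ H w := fun w =>
      ⟨fun ⟨w', h, hw⟩ => (hH _ _ h).1 hw, fun h => ⟨w, rfl, h⟩⟩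
    rw [hmul] at huv hvu
    have := circular_eq_idempotent hN (f := fun y => ∃ w', φ w' = y ∧ H w') (x := φ u) (y := φ v)
      (fun y z => by
        obtain ⟨u, rfl⟩ := hsurj y
        obtain ⟨v, rfl⟩ := hsurj z
        rw [← hmul, ← hmul, hf, hf, hcirc]) he
      (hex.trans hu.1) (hex.trans hv.1) (huv.2.trans hxe) (hvu.2.trans hxe)
    rwa [← hmul, hf, hf] at this
  by_cases hw₀ : H w₀
  · right
    have h2 := hbad (fun w => ¬ H w) fun u v hu hv huv hvu =>
      not_not.2 ((key u v hu hv huv hvu).2 hw₀)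
    simp only [pr_not] at h2
    simpa using (tendsto_const_nhds (x := (1 : ℝ))).sub h2
  · left
    exact hbad H fun u v hu hv huv hvu => fun h => hw₀ ((key u v hu hv huv hvu).1 h)

end ZeroOne

/-! ### Hitting times of ideals -/

section Submultiplicative

variable {a : ℕ → ℝ}

theorem submul_antitone (h0 : ∀ n, 0 ≤ a n) (h1 : ∀ n, a n ≤ 1)
    (hmul : ∀ m n, a (m + n) ≤ a m * a n) : Antitone a := by
  refine antitone_nat_of_succ_le fun n => (hmul n 1).trans ?_
  exact mul_le_of_le_one_right (h0 n) (h1 1)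

theorem submul_mul_le (h0 : ∀ n, 0 ≤ a n) (h1 : ∀ n, a n ≤ 1)
    (hmul : ∀ m n, a (m + n) ≤ a m * a n) (m j : ℕ) : a (j * m) ≤ a m ^ j := by
  induction j with
  | zero => simpa using h1 0
  | succ j ih =>
    rw [Nat.succ_mul, pow_succ]
    exact (hmul _ _).trans (mul_le_mul_of_nonneg_right ih (h0 m))

/-- A Markov bound: avoidance up to time `m` is at most the mean hitting time over `m`. -/
theorem mul_le_sum_range (h0 : ∀ n, 0 ≤ a n) (h1 : ∀ n, a n ≤ 1)
    (hmul : ∀ m n, a (m + n) ≤ a m * a n) (m : ℕ) : m * a m ≤ ∑ i ∈ Finset.range m, a i := by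
  have := Finset.card_nsmul_le_sum (Finset.range m) a (a m) fun i hi =>
    submul_antitone h0 h1 hmul (Finset.mem_range.1 hi).le
  simpa using this

/-- Blocks of `m` indices bound the sum by `m` times a geometric series of ratio `a m`. A long mean
hitting time thus makes an early hit unlikely. -/
theorem one_sub_mul_sum_le (h0 : ∀ n, 0 ≤ a n) (h1 : ∀ n, a n ≤ 1)
    (hmul : ∀ m n, a (m + n) ≤ a m * a n) {m : ℕ} (hm : 0 < m) (n : ℕ) :
    (1 - a m) * ∑ i ∈ Finset.range n, a i ≤ m := by
  have hj : ∀ j : ℕ, ∑ i ∈ Finset.range (j * m), a i ≤ m * ∑ i ∈ Finset.range j, a m ^ i := by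
    intro j
    induction j with
    | zero => simp
    | succ j ih =>
      rw [Nat.succ_mul, Finset.sum_range_add, Finset.sum_range_succ, mul_add]
      refine add_le_add ih ?_
      have := Finset.sum_le_card_nsmul (Finset.range m) (fun i => a (j * m + i)) (a m ^ j)
        fun i _ => ((submul_antitone h0 h1 hmul) (Nat.le_add_right _ _)).trans
          (submul_mul_le h0 h1 hmul m j)
      simpa using this
  have hle : ∑ i ∈ Finset.range n, a i ≤ ∑ i ∈ Finset.range (n * m), a i :=
    Finset.sum_le_sum_of_subset_of_nonneg
      (Finset.range_mono (Nat.le_mul_of_pos_right n hm)) fun i _ _ => h0 i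
  have hsub : 0 ≤ 1 - a m := sub_nonneg.2 (h1 m)
  calc (1 - a m) * ∑ i ∈ Finset.range n, a i
      ≤ (1 - a m) * (m * ∑ i ∈ Finset.range n, a m ^ i) :=
        mul_le_mul_of_nonneg_left (hle.trans (hj n)) hsub
    _ = m * ((1 - a m) * ∑ i ∈ Finset.range n, a m ^ i) := by ring
    _ = m * (1 - a m ^ n) := by rw [mul_neg_geom_sum]
    _ ≤ m := mul_le_of_le_one_right (Nat.cast_nonneg m) (by linarith [pow_nonneg (h0 m) n])

end Submultiplicative

open Polynomial in
/-- The quotient of two polynomials has an integral order at zero. -/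
theorem polynomial_dichotomy (P D : ℝ[X]) (hD : D ≠ 0) (k : ℕ) :
    (∃ C : ℝ, 0 < C ∧ ∀ᶠ p in 𝓝[>] (0 : ℝ), |P.eval p| * p ^ k ≤ C * |D.eval p|) ∨
    (∃ c : ℝ, 0 < c ∧ ∀ᶠ p in 𝓝[>] (0 : ℝ), c * |D.eval p| ≤ |P.eval p| * p ^ (k + 1)) := by
  -- Near `0` from the right, a nonzero polynomial is comparable with `p ^ r`, where `r` is the
  -- multiplicity of its root `0`. Being integers, the orders `n` of `P` and `m` of `D` satisfy `m ≤
  -- n + k` or `m ≥ n + k + 1`.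
  have hfac : ∀ R : ℝ[X], R ≠ 0 → ∃ (n : ℕ) (c C : ℝ), 0 < c ∧ 0 < C ∧
      ∀ᶠ p in 𝓝[>] (0 : ℝ), c * p ^ n ≤ |R.eval p| ∧ |R.eval p| ≤ C * p ^ n := by
    intro R hR
    obtain ⟨S, hS, hdvd⟩ := R.exists_eq_pow_rootMultiplicity_mul_and_not_dvd hR 0
    rw [map_zero, sub_zero] at hS hdvd
    have hS0 : S.eval 0 ≠ 0 := by
      rwa [X_dvd_iff, coeff_zero_eq_eval_zero] at hdvd
    have hpos : 0 < |S.eval 0| := abs_pos.2 hS0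
    have hlim : Tendsto (fun p => |S.eval p|) (𝓝[>] (0 : ℝ)) (𝓝 |S.eval 0|) :=
      (S.continuous.abs.tendsto 0).mono_left nhdsWithin_le_nhds
    refine ⟨R.rootMultiplicity 0, |S.eval 0| / 2, 2 * |S.eval 0|, by positivity, by positivity, ?_⟩
    filter_upwards [hlim.eventually_const_lt (half_lt_self hpos),
      hlim.eventually_lt_const (by linarith : |S.eval 0| < 2 * |S.eval 0|),
      self_mem_nhdsWithin] with p h1 h2 (h3 : 0 < p)
    have h4 : |R.eval p| = |S.eval p| * p ^ R.rootMultiplicity 0 := by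
      conv_lhs => rw [hS]
      rw [eval_mul, eval_pow, eval_X, abs_mul, abs_of_pos (pow_pos h3 _), mul_comm]
    rw [h4]
    exact ⟨mul_le_mul_of_nonneg_right h1.le (by positivity),
      mul_le_mul_of_nonneg_right h2.le (by positivity)⟩
  rcases eq_or_ne P 0 with rfl | hP
  · exact Or.inl ⟨1, one_pos, Eventually.of_forall fun p => by simp⟩
  obtain ⟨n, c, C, hc, hC, hn⟩ := hfac P hP
  obtain ⟨m, c', C', hc', hC', hm⟩ := hfac D hD
  have hlt1 : ∀ᶠ p in 𝓝[>] (0 : ℝ), p < 1 := nhdsWithin_le_nhds (Iio_mem_nhds one_pos)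
  rcases le_or_gt m (n + k) with h | h
  · refine Or.inl ⟨C / c', by positivity, ?_⟩
    filter_upwards [hn, hm, hlt1, self_mem_nhdsWithin] with p h1 h2 h3 (h4 : 0 < p)
    calc |P.eval p| * p ^ k ≤ C * p ^ n * p ^ k :=
          mul_le_mul_of_nonneg_right h1.2 (by positivity)
      _ = C * p ^ (n + k) := by ring
      _ ≤ C * p ^ m :=
          mul_le_mul_of_nonneg_left (pow_le_pow_of_le_one h4.le h3.le h) hC.le
      _ = C / c' * (c' * p ^ m) := by field_simp
      _ ≤ C / c' * |D.eval p| := mul_le_mul_of_nonneg_left h2.1 (by positivity)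
  · refine Or.inr ⟨c / C', by positivity, ?_⟩
    filter_upwards [hn, hm, hlt1, self_mem_nhdsWithin] with p h1 h2 h3 (h4 : 0 < p)
    calc c / C' * |D.eval p| ≤ c / C' * (C' * p ^ m) :=
          mul_le_mul_of_nonneg_left h2.2 (by positivity)
      _ = c * p ^ m := by field_simp
      _ ≤ c * p ^ (n + (k + 1)) :=
          mul_le_mul_of_nonneg_left (pow_le_pow_of_le_one h4.le h3.le h) hc.le
      _ = c * p ^ n * p ^ (k + 1) := by ring
      _ ≤ |P.eval p| * p ^ (k + 1) := mul_le_mul_of_nonneg_right h1.1 (by positivity)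

section Ideals

variable {M : Type*} [Monoid M] {φ : List Bool → M} {p : ℝ} {x : M}

/-- The probability that a random word avoids the ideal generated by `x`. -/
noncomputable def avoid (φ : List Bool → M) (x : M) (p : ℝ) (n : ℕ) : ℝ :=
  pr p n fun w => ¬ InIdeal x (φ w)

theorem avoid_nonneg (h0 : 0 ≤ p) (h1 : p ≤ 1) (n : ℕ) : 0 ≤ avoid φ x p n := pr_nonneg h0 h1 _ _

theorem avoid_le_one (h0 : 0 ≤ p) (h1 : p ≤ 1) (n : ℕ) : avoid φ x p n ≤ 1 := pr_le_one h0 h1 _ _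

/-- Ideals absorb products, so a word avoiding one has both of its independent factors avoiding it.
-/
theorem avoid_add_le (hmul : ∀ u v, φ (u ++ v) = φ u * φ v) (h0 : 0 ≤ p) (h1 : p ≤ 1) (m n : ℕ) :
    avoid φ x p (m + n) ≤ avoid φ x p m * avoid φ x p n := by
  refine pr_append_le h0 h1 fun u v _ _ h => ?_
  rw [hmul] at h
  exact ⟨fun h' => h (h'.mul_right _), fun h' => h (h'.mul_left _)⟩

theorem le_pr_eq (h0 : 0 ≤ p) (h1 : p ≤ 1) (w : List Bool) :
    (p * (1 - p)) ^ w.length ≤ pr p w.length (fun u => u = w) := by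
  have h2 : 0 ≤ 1 - p := sub_nonneg.2 h1
  induction w with
  | nil => simp [pr, expect]
  | cons b w ih =>
    rw [List.length_cons, pow_succ']
    have hb : p * (1 - p) ≤ pr p 1 (fun u => u = [b]) := by
      cases b <;> simp [pr, expect] <;> nlinarith
    refine (mul_le_mul hb ih (by positivity) (pr_nonneg h0 h1 _ _)).trans ?_
    rw [add_comm w.length 1]
    exact le_pr_append h0 h1 fun u v _ _ hu hv => by simp [hu, hv]

/-- `L` is the length of a word with value `x`; spelling that word already hits the ideal. As `L`
may be `0`, later divisions use `L + 1`. -/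
theorem avoid_le (hsurj : Function.Surjective φ) (x : M) : ∃ L : ℕ, ∀ p : ℝ, 0 ≤ p → p ≤ 1 →
    avoid φ x p L ≤ 1 - (p * (1 - p)) ^ L := by
  obtain ⟨w, rfl⟩ := hsurj x
  refine ⟨w.length, fun p h0 h1 => ?_⟩
  rw [avoid, pr_not]
  refine sub_le_sub_left ((le_pr_eq h0 h1 w).trans (pr_mono h0 h1 ?_)) 1
  rintro u _ rfl
  exact InIdeal.refl _

theorem tendsto_avoid (hmul : ∀ u v, φ (u ++ v) = φ u * φ v) (hsurj : Function.Surjective φ)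
    (h0 : 0 < p) (h1 : p < 1) : Tendsto (avoid φ x p) atTop (𝓝 0) := by
  obtain ⟨L, hL⟩ := avoid_le hsurj x
  have hlt : avoid φ x p L < 1 := by
    have : 0 < (p * (1 - p)) ^ L := pow_pos (mul_pos h0 (sub_pos.2 h1)) L
    linarith [hL p h0.le h1.le]
  have hn := avoid_nonneg (φ := φ) (x := x) h0.le h1.le
  have h1' := avoid_le_one (φ := φ) (x := x) h0.le h1.le
  have hm := avoid_add_le (x := x) hmul h0.le h1.le
  have hpow := tendsto_pow_atTop_nhds_zero_of_lt_one (hn L) hlt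
  refine squeeze_zero hn (g := fun n => avoid φ x p L ^ (n / (L + 1))) (fun n => ?_)
    (hpow.comp (Nat.tendsto_div_const_atTop (by omega)))
  refine (submul_antitone hn h1' hm ?_).trans (submul_mul_le hn h1' hm L _)
  exact (Nat.mul_le_mul_left _ (Nat.le_succ L)).trans (Nat.div_mul_le_self n (L + 1))

open Polynomial Matrix in
/-- The expected time to hit an ideal is a rational function of the probability. -/
theorem exists_polynomial_tendsto [Finite M] (hmul : ∀ u v, φ (u ++ v) = φ u * φ v)
    (hone : φ [] = 1) (hsurj : Function.Surjective φ) (x : M) :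
    ∃ P D : ℝ[X], ∀ p : ℝ, 0 < p → p < 1 → D.eval p ≠ 0 ∧
      Tendsto (fun n => D.eval p * ∑ i ∈ Finset.range n, avoid φ x p i) atTop
        (𝓝 (P.eval p)) := by
  classical
  have := Fintype.ofFinite M
  -- Identity minus the transition matrix of the walk `y ↦ y * φ [letter]` killed on the ideal. The
  -- mean hitting times solve the linear system with right-hand side `b`, the indicator of the
  -- complement.
  let A : Matrix M M ℝ[X] := 1 - Matrix.of fun y z => if InIdeal x y then 0 else
    X * (if y * φ [true] = z then 1 else 0) + (1 - X) * (if y * φ [false] = z then 1 else 0)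
  let b : M → ℝ[X] := fun y => if InIdeal x y then 0 else 1
  refine ⟨(A.adjugate *ᵥ b) 1, A.det, fun p h0 h1 => ?_⟩
  let B : Matrix M M ℝ := (evalRingHom p).mapMatrix A
  let h : ℕ → M → ℝ := fun n y => pr p n fun w => ¬ InIdeal x (y * φ w)
  have hdet : A.det.eval p = B.det := RingHom.map_det (evalRingHom p) A
  have hB : ∀ (v : M → ℝ) (y : M), (B *ᵥ v) y = v y - if InIdeal x y then 0 else
      p * v (y * φ [true]) + (1 - p) * v (y * φ [false]) := by
    intro v y
    have : B = 1 - Matrix.of fun y z => if InIdeal x y then 0 else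
        p * (if y * φ [true] = z then 1 else 0) +
          (1 - p) * (if y * φ [false] = z then 1 else 0) := by
      ext y z
      simp only [B, A, RingHom.mapMatrix_apply, Matrix.map_apply, Matrix.sub_apply,
        Matrix.of_apply, coe_evalRingHom, eval_sub, Matrix.one_apply]
      split_ifs <;> simp
    rw [this, Matrix.sub_mulVec, Matrix.one_mulVec, Pi.sub_apply]
    congr 1
    simp only [Matrix.mulVec, dotProduct, Matrix.of_apply]
    split_ifs
    · simp
    · simp [add_mul, Finset.sum_add_distrib]
  have hzero : ∀ n y, InIdeal x y → h n y = 0 := by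
    intro n y hy
    have : ∀ w, InIdeal x (y * φ w) := fun w => hy.mul_right _
    simp [h, this, pr, expect_const]
  have hsucc : ∀ n y, h (n + 1) y =
      p * h n (y * φ [true]) + (1 - p) * h n (y * φ [false]) := by
    intro n y
    have : ∀ c : Bool, (fun w => ¬ InIdeal x (y * φ (c :: w))) =
        fun w => ¬ InIdeal x (y * φ [c] * φ w) := fun c => by
      funext w
      rw [mul_assoc, ← hmul]; rfl
    change p * pr p n (fun w => ¬ InIdeal x (y * φ (true :: w))) +
      (1 - p) * pr p n (fun w => ¬ InIdeal x (y * φ (false :: w))) = _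
    rw [this, this]
  have hinit : ∀ y, ¬ InIdeal x y → h 0 y = 1 := by
    intro y hy
    refine if_pos ?_
    change ¬ InIdeal x (y * φ [])
    rwa [hone, mul_one]
  have hle : ∀ n y, h n y ≤ avoid φ x p n := fun n y =>
    pr_mono h0.le h1.le fun w _ hw hw' => hw (hw'.mul_left _)
  have hlim : ∀ y, Tendsto (fun n => h n y) atTop (𝓝 0) := fun y =>
    squeeze_zero (fun n => pr_nonneg h0.le h1.le _ _) (fun n => hle n y)
      (tendsto_avoid hmul hsurj h0 h1)
  -- By telescoping, the partial sums solve the system up to the survival probability `h n`, which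
  -- tends to zero.
  have hBh : ∀ n, B *ᵥ (fun y => ∑ i ∈ Finset.range n, h i y) = fun y => h 0 y - h n y := by
    intro n
    funext y
    rw [hB]
    by_cases hy : InIdeal x y
    · simp [hy, hzero]
    · rw [if_neg hy, Finset.mul_sum, Finset.mul_sum, ← Finset.sum_add_distrib]
      simp only [← hsucc]
      rw [← Finset.sum_sub_distrib, Finset.sum_range_sub']
  constructor
  · rw [hdet]
    intro hd
    obtain ⟨v, hv0, hv⟩ := Matrix.exists_mulVec_eq_zero_iff.2 hd
    have hv' : ∀ y, v y = if InIdeal x y then 0 else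
        p * v (y * φ [true]) + (1 - p) * v (y * φ [false]) := by
      intro y
      have := congrFun hv y
      rw [hB, Pi.zero_apply] at this
      linarith
    -- A kernel vector is harmonic for the killed walk, so it is dominated by a multiple of the
    -- survival probability and must vanish.
    have hbound : ∀ n y, |v y| ≤ (∑ z, |v z|) * h n y := by
      intro n
      induction n with
      | zero =>
        intro y
        by_cases hy : InIdeal x y
        · rw [hv', if_pos hy, hzero _ _ hy]; simp
        · rw [hinit y hy, mul_one]
          exact Finset.single_le_sum (f := fun z => |v z|) (fun z _ => abs_nonneg _)
            (Finset.mem_univ y)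
      | succ n ih =>
        intro y
        by_cases hy : InIdeal x y
        · rw [hv', if_pos hy, hzero _ _ hy]; simp
        · rw [hv', if_neg hy, hsucc]
          calc _ ≤ |p * v (y * φ [true])| + |(1 - p) * v (y * φ [false])| := abs_add_le _ _
            _ = p * |v (y * φ [true])| + (1 - p) * |v (y * φ [false])| := by
                rw [abs_mul, abs_mul, abs_of_pos h0, abs_of_pos (sub_pos.2 h1)]
            _ ≤ p * ((∑ z, |v z|) * h n (y * φ [true])) +
                (1 - p) * ((∑ z, |v z|) * h n (y * φ [false])) :=
                add_le_add (mul_le_mul_of_nonneg_left (ih _) h0.le)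
                  (mul_le_mul_of_nonneg_left (ih _) (sub_pos.2 h1).le)
            _ = _ := by ring
    refine hv0 (funext fun y => abs_nonpos_iff.1 ?_)
    have := (hlim y).const_mul (∑ z, |v z|)
    rw [mul_zero] at this
    exact ge_of_tendsto' this fun n => hbound n y
  · have hP : ((A.adjugate *ᵥ b) 1).eval p = (B.adjugate *ᵥ fun y => h 0 y) 1 := by
      have h2 := RingHom.map_mulVec (evalRingHom p) A.adjugate b 1
      have h3 : (evalRingHom p).mapMatrix A.adjugate = B.adjugate :=
        RingHom.map_adjugate (evalRingHom p) A
      rw [coe_evalRingHom] at h2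
      rw [h2, ← h3]
      congr 1
      funext y
      by_cases hy : InIdeal x y
      · simp [b, hy, hzero]
      · simp [b, hy, hinit]
    have hE : ∀ n, A.det.eval p * ∑ i ∈ Finset.range n, avoid φ x p i =
        (B.adjugate *ᵥ fun y => h 0 y - h n y) 1 := by
      intro n
      rw [← hBh n, Matrix.mulVec_mulVec, Matrix.adjugate_mul, Matrix.smul_mulVec,
        Matrix.one_mulVec, hdet]
      simp [h, avoid]
    simp only [hE, hP]
    have hvec : Tendsto (fun n => fun y => h 0 y - h n y) atTop (𝓝 fun y => h 0 y) := by
      rw [tendsto_pi_nhds]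
      intro y
      simpa using (tendsto_const_nhds (x := h 0 y)).sub (hlim y)
    have hcont : Continuous fun v : M → ℝ => (B.adjugate *ᵥ v) 1 := by
      simp only [Matrix.mulVec, dotProduct]
      fun_prop
    exact (hcont.tendsto _).comp hvec

end Ideals

/-! ### Every ideal is hit or avoided -/

section Decide

variable {M : Type*} [Monoid M] [Finite M] {φ : List Bool → M} {p : ℕ → ℝ}

theorem ideal_dichotomy_of_window (hmul : ∀ u v, φ (u ++ v) = φ u * φ v) (hone : φ [] = 1)
    (hsurj : Function.Surjective φ) (h0 : ∀ n, 0 ≤ p n) (h1 : ∀ n, p n ≤ 1) {k : ℕ}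
    (hp : Tendsto p atTop (𝓝[>] 0)) (hk : Tendsto (fun n : ℕ => n * p n ^ k) atTop atTop)
    (hk' : Tendsto (fun n : ℕ => n * p n ^ (k + 1)) atTop (𝓝 0)) (x : M) :
    (∀ m, Comparable m → Tendsto (fun n => pr (p n) (m n) fun w => InIdeal x (φ w))
        atTop (𝓝 1)) ∨
      (∀ m, Comparable m → Tendsto (fun n => pr (p n) (m n) fun w => InIdeal x (φ w))
        atTop (𝓝 0)) := by
  obtain ⟨P, D, hPD⟩ := exists_polynomial_tendsto hmul hone hsurj x
  have hD : D ≠ 0 := by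
    rintro rfl
    exact (hPD (1 / 2) (by norm_num) (by norm_num)).1 (by simp)
  have hpos : ∀ᶠ n in atTop, 0 < p n := hp.eventually self_mem_nhdsWithin
  have hlt : ∀ᶠ n in atTop, p n < 1 :=
    hp.eventually (nhdsWithin_le_nhds (Iio_mem_nhds one_pos))
  have hn := fun n => avoid_nonneg (φ := φ) (x := x) (h0 n) (h1 n)
  have hn1 := fun n => avoid_le_one (φ := φ) (x := x) (h0 n) (h1 n)
  have hm := fun n => avoid_add_le (x := x) hmul (h0 n) (h1 n)
  have habs : ∀ {q : ℝ}, 0 < q → q < 1 →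
      Tendsto (fun n => |D.eval q| * ∑ i ∈ Finset.range n, avoid φ x q i) atTop
        (𝓝 |P.eval q|) := by
    intro q hq0 hq1
    refine (hPD q hq0 hq1).2.abs.congr fun n => ?_
    rw [abs_mul, abs_of_nonneg (a := ∑ i ∈ Finset.range n, avoid φ x q i)]
    exact Finset.sum_nonneg fun i _ => avoid_nonneg hq0.le hq1.le i
  rcases polynomial_dichotomy P D hD k with ⟨C, hC, hev⟩ | ⟨c, hc, hev⟩
  -- Here `T = |P| / |D| ≤ C * p ^ (-k)`, so the avoidance probability is at most `T / m ≤ 3 * C /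
  -- (n * p ^ k)`.
  · left
    intro m hcomp
    have hlim : Tendsto (fun n : ℕ => 3 * C / (n * p n ^ k)) atTop (𝓝 0) :=
      tendsto_const_nhds.div_atTop hk
    have hav : Tendsto (fun n => avoid φ x (p n) (m n)) atTop (𝓝 0) := by
      refine squeeze_zero' (Eventually.of_forall fun n => hn n _) ?_ hlim
      filter_upwards [hp.eventually hev, hpos, hlt, hcomp, eventually_gt_atTop 0] with
        n h2 h3 h4 h5 h6
      have hDpos : 0 < |D.eval (p n)| := abs_pos.2 (hPD _ h3 h4).1
      have hmono : Monotone fun l => |D.eval (p n)| * ∑ i ∈ Finset.range l, avoid φ x (p n) i :=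
        fun i j hij => mul_le_mul_of_nonneg_left (Finset.sum_le_sum_of_subset_of_nonneg
          (Finset.range_mono hij) fun l _ _ => hn n l) hDpos.le
      have h7 := hmono.ge_of_tendsto (habs h3 h4) (m n)
      have h8 := mul_le_sum_range (hn n) (hn1 n) (hm n) (m n)
      have h9 : |D.eval (p n)| * ((m n) * avoid φ x (p n) (m n) * p n ^ k) ≤
          |D.eval (p n)| * C := by
        calc _ = |D.eval (p n)| * ((m n) * avoid φ x (p n) (m n)) * p n ^ k := by ring
          _ ≤ |P.eval (p n)| * p n ^ k := mul_le_mul_of_nonneg_right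
              ((mul_le_mul_of_nonneg_left h8 hDpos.le).trans h7) (by positivity)
          _ ≤ _ := by rw [mul_comm _ C]; exact h2
      have h10 := le_of_mul_le_mul_left h9 hDpos
      have h11 : (n : ℝ) ≤ 3 * m n := by exact_mod_cast h5.2
      rw [le_div_iff₀ (by positivity)]
      calc avoid φ x (p n) (m n) * (n * p n ^ k)
          ≤ avoid φ x (p n) (m n) * (3 * m n * p n ^ k) := by
            have := hn n (m n); gcongr
        _ = 3 * (m n * avoid φ x (p n) (m n) * p n ^ k) := by ring
        _ ≤ 3 * C := by gcongr
    have := (tendsto_const_nhds (x := (1 : ℝ))).sub hav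
    simpa [avoid, pr_not] using this
  -- Here `T ≥ c * p ^ (-(k + 1))`, so the hitting probability is at most `m / T ≤ n * p ^ (k + 1) /
  -- c`.
  · right
    intro m hcomp
    have hlim : Tendsto (fun n : ℕ => (n * p n ^ (k + 1)) / c) atTop (𝓝 0) := by
      simpa using hk'.div_const c
    refine squeeze_zero' (Eventually.of_forall fun n => pr_nonneg (h0 n) (h1 n) _ _) ?_ hlim
    filter_upwards [hp.eventually hev, hpos, hlt, hcomp, eventually_gt_atTop 0] with
      n h2 h3 h4 h5 h6
    have hDpos : 0 < |D.eval (p n)| := abs_pos.2 (hPD _ h3 h4).1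
    have hm0 : 0 < m n := by omega
    have h7 : (1 - avoid φ x (p n) (m n)) * |P.eval (p n)| ≤ m n * |D.eval (p n)| := by
      refine le_of_tendsto' ((habs h3 h4).const_mul (1 - avoid φ x (p n) (m n))) fun l => ?_
      have := one_sub_mul_sum_le (hn n) (hn1 n) (hm n) hm0 l
      nlinarith
    have h8 : pr (p n) (m n) (fun w => InIdeal x (φ w)) = 1 - avoid φ x (p n) (m n) := by
      rw [avoid, pr_not]; ring
    rw [h8, le_div_iff₀ hc]
    have h9 : 0 ≤ 1 - avoid φ x (p n) (m n) := sub_nonneg.2 (hn1 n _)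
    refine le_of_mul_le_mul_left (a := |D.eval (p n)|) ?_ hDpos
    calc |D.eval (p n)| * ((1 - avoid φ x (p n) (m n)) * c)
        = (1 - avoid φ x (p n) (m n)) * (c * |D.eval (p n)|) := by ring
      _ ≤ (1 - avoid φ x (p n) (m n)) * (|P.eval (p n)| * p n ^ (k + 1)) :=
          mul_le_mul_of_nonneg_left h2 h9
      _ = ((1 - avoid φ x (p n) (m n)) * |P.eval (p n)|) * p n ^ (k + 1) := by ring
      _ ≤ (m n * |D.eval (p n)|) * p n ^ (k + 1) :=
          mul_le_mul_of_nonneg_right h7 (by positivity)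
      _ ≤ (n * |D.eval (p n)|) * p n ^ (k + 1) := by
          have : (m n : ℝ) ≤ n := by exact_mod_cast h5.1
          gcongr
      _ = _ := by ring

-- Among `m / (L + 1)` disjoint blocks of length `L`, each spells a fixed word with value `x` with
-- probability at least `(p * (1 - p)) ^ L`, and the mean number of successes tends to infinity.
omit [Finite M] in
theorem ideal_hit_of_rich (hmul : ∀ u v, φ (u ++ v) = φ u * φ v)
    (hsurj : Function.Surjective φ) (h0 : ∀ n, 0 ≤ p n) (h1 : ∀ n, p n ≤ 1)
    (hp : ∀ L : ℕ, Tendsto (fun n : ℕ => n * (p n * (1 - p n)) ^ L) atTop atTop) (x : M)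
    {m : ℕ → ℕ} (hcomp : Comparable m) :
    Tendsto (fun n => pr (p n) (m n) fun w => InIdeal x (φ w)) atTop (𝓝 1) := by
  obtain ⟨L, hL⟩ := avoid_le hsurj x
  have hn := fun n => avoid_nonneg (φ := φ) (x := x) (h0 n) (h1 n)
  have hn1 := fun n => avoid_le_one (φ := φ) (x := x) (h0 n) (h1 n)
  have hm := fun n => avoid_add_le (x := x) hmul (h0 n) (h1 n)
  have hs : ∀ n, 0 ≤ (p n * (1 - p n)) ^ L := fun n =>
    pow_nonneg (mul_nonneg (h0 n) (sub_nonneg.2 (h1 n))) L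
  have hs1 : ∀ n, (p n * (1 - p n)) ^ L ≤ 1 := fun n =>
    pow_le_one₀ (mul_nonneg (h0 n) (sub_nonneg.2 (h1 n))) (by nlinarith [h0 n, h1 n])
  have hj : Tendsto (fun n : ℕ => ((m n / (L + 1) : ℕ) : ℝ) * (p n * (1 - p n)) ^ L)
      atTop atTop := by
    have h2 : Tendsto (fun n : ℕ => (n * (p n * (1 - p n)) ^ L) / (3 * (L + 1)) - 1)
        atTop atTop :=
      tendsto_atTop_add_const_right _ _ ((hp L).atTop_div_const (by positivity))
    refine tendsto_atTop_mono' _ ?_ h2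
    filter_upwards [hcomp] with n h3
    have h4 : n ≤ 3 * (L + 1) * (m n / (L + 1)) + 3 * (L + 1) := by
      have h5 := Nat.div_add_mod (m n) (L + 1)
      have h6 : m n % (L + 1) < L + 1 := Nat.mod_lt (m n) (Nat.succ_pos L)
      have h7 : 3 * (L + 1) * (m n / (L + 1)) = 3 * ((L + 1) * (m n / (L + 1))) := by ring
      omega
    have h5 : (n : ℝ) ≤ 3 * (L + 1) * ((m n / (L + 1) : ℕ) : ℝ) + 3 * (L + 1) := by
      exact_mod_cast h4
    rw [sub_le_iff_le_add, div_le_iff₀ (by positivity)]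
    have h8 : (0 : ℝ) ≤ 3 * (L + 1) := by positivity
    nlinarith [mul_le_mul_of_nonneg_right h5 (hs n), mul_le_mul_of_nonneg_left (hs1 n) h8]
  have hav : Tendsto (fun n => avoid φ x (p n) (m n)) atTop (𝓝 0) := by
    refine squeeze_zero (fun n => hn n _) (fun n => ?_)
      (Real.tendsto_exp_atBot.comp (tendsto_neg_atTop_atBot.comp hj))
    calc avoid φ x (p n) (m n) ≤ avoid φ x (p n) L ^ (m n / (L + 1)) := by
          refine (submul_antitone (hn n) (hn1 n) (hm n) ?_).trans
            (submul_mul_le (hn n) (hn1 n) (hm n) L _)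
          exact (Nat.mul_le_mul_left _ (Nat.le_succ L)).trans (Nat.div_mul_le_self _ (L + 1))
      _ ≤ Real.exp (-(p n * (1 - p n)) ^ L) ^ (m n / (L + 1)) := by
          refine pow_le_pow_left₀ (hn n L) ((hL _ (h0 n) (h1 n)).trans ?_) _
          linarith [Real.add_one_le_exp (-(p n * (1 - p n)) ^ L)]
      _ = _ := by
          rw [← Real.exp_nat_mul]
          simp
  have := (tendsto_const_nhds (x := (1 : ℝ))).sub hav
  simpa [avoid, pr_not] using this

end Decide

/-! ### Harris's inequality and runs of `true` -/

section Harris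

variable {p : ℝ}

/-- A function of words that does not increase when letters are changed from `false` to `true`. -/
def Decreasing (g : List Bool → ℝ) : Prop := ∀ u v, List.Forall₂ (· ≤ ·) u v → g v ≤ g u

theorem Decreasing.cons {g : List Bool → ℝ} (hg : Decreasing g) (b : Bool) :
    Decreasing fun w => g (b :: w) := fun _ _ h => hg _ _ (List.Forall₂.cons le_rfl h)

theorem Decreasing.expect_cons_le (h0 : 0 ≤ p) (h1 : p ≤ 1) {g : List Bool → ℝ}
    (hg : Decreasing g) (n : ℕ) :
    expect p n (fun w => g (true :: w)) ≤ expect p n (fun w => g (false :: w)) :=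
  expect_mono h0 h1 fun w _ =>
    hg _ _ (List.Forall₂.cons (Bool.false_le _) (List.forall₂_refl w))

/-- Harris's inequality. -/
theorem expect_mul_le (h0 : 0 ≤ p) (h1 : p ≤ 1) (n : ℕ) {g h : List Bool → ℝ}
    (hg : Decreasing g) (hh : Decreasing h) :
    expect p n g * expect p n h ≤ expect p n fun w => g w * h w := by
  induction n generalizing g h with
  | zero => exact le_rfl
  | succ n ih =>
    have h2 := mul_le_mul_of_nonneg_left (ih (hg.cons true) (hh.cons true)) h0
    have h3 := mul_le_mul_of_nonneg_left (ih (hg.cons false) (hh.cons false)) (sub_nonneg.2 h1)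
    have h4 := mul_nonneg (mul_nonneg h0 (sub_nonneg.2 h1)) (mul_nonneg
      (sub_nonneg.2 (hg.expect_cons_le h0 h1 n)) (sub_nonneg.2 (hh.expect_cons_le h0 h1 n)))
    simp only [expect]
    nlinarith

theorem pr_mul_le (h0 : 0 ≤ p) (h1 : p ≤ 1) (n : ℕ) {A B : List Bool → Prop}
    (hA : ∀ u v, List.Forall₂ (· ≤ ·) u v → A v → A u)
    (hB : ∀ u v, List.Forall₂ (· ≤ ·) u v → B v → B u) :
    pr p n A * pr p n B ≤ pr p n fun w => A w ∧ B w := by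
  classical
  have hdec : ∀ {A : List Bool → Prop}, (∀ u v, List.Forall₂ (· ≤ ·) u v → A v → A u) →
      Decreasing fun w => if A w then 1 else 0 := fun hA u v h => by
    have := hA u v h
    dsimp only
    split_ifs <;> first | (exfalso; tauto) | norm_num
  refine (expect_mul_le h0 h1 n (hdec hA) (hdec hB)).trans (expect_mono h0 h1 fun w _ => ?_)
  split_ifs <;> first | (exfalso; tauto) | norm_num

end Harris

/-- The word starts with `k` letters `true`. -/
def StartsOnes (k : ℕ) (w : List Bool) : Prop := ∀ j < k, w[j]? = some true

/-- The word contains `k` consecutive letters `true`. -/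
def HasBlock (k : ℕ) (w : List Bool) : Prop := ∃ i, ∀ j < k, w[i + j]? = some true

/-- The word, read as a circular word, contains `k` consecutive letters `true`. -/
def CircRun (k : ℕ) (w : List Bool) : Prop :=
  ∃ i < w.length, ∀ j < k, w[(i + j) % w.length]? = some true

theorem hasBlock_cons {k : ℕ} {b : Bool} {w : List Bool} :
    HasBlock k (b :: w) ↔ StartsOnes k (b :: w) ∨ HasBlock k w := by
  constructor
  · rintro ⟨i, hi⟩
    rcases i with _ | i
    · exact Or.inl fun j hj => by simpa using hi j hj
    · exact Or.inr ⟨i, fun j hj => by simpa [Nat.add_right_comm] using hi j hj⟩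
  · rintro (h | ⟨i, hi⟩)
    · exact ⟨0, fun j hj => by simpa using h j hj⟩
    · exact ⟨i + 1, fun j hj => by simpa [Nat.add_right_comm] using hi j hj⟩

theorem getElem?_true_of_le {u v : List Bool} (h : List.Forall₂ (· ≤ ·) u v) {i : ℕ}
    (hu : u[i]? = some true) : v[i]? = some true := by
  induction h generalizing i with
  | nil => exact hu
  | @cons a b u v hab _ ih =>
    rcases i with _ | i
    · simp only [List.getElem?_cons_zero, Option.some.injEq] at hu ⊢
      subst hu
      exact Bool.eq_true_of_true_le hab
    · simp only [List.getElem?_cons_succ] at hu ⊢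
      exact ih hu

theorem StartsOnes.of_le {k : ℕ} {u v : List Bool} (h : List.Forall₂ (· ≤ ·) u v)
    (hu : StartsOnes k u) : StartsOnes k v := fun j hj => getElem?_true_of_le h (hu j hj)

theorem HasBlock.of_le {k : ℕ} {u v : List Bool} (h : List.Forall₂ (· ≤ ·) u v) :
    HasBlock k u → HasBlock k v := fun ⟨i, hi⟩ =>
  ⟨i, fun j hj => getElem?_true_of_le h (hi j hj)⟩

section Runs

variable {p : ℝ} {k : ℕ}

/-- The probability that a random word has no `k` consecutive letters `true`. -/
noncomputable def noBlock (k : ℕ) (p : ℝ) (n : ℕ) : ℝ := pr p n fun w => ¬ HasBlock k w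

theorem pr_ones (p : ℝ) (k : ℕ) : pr p k (fun w => w = List.replicate k true) = p ^ k := by
  classical
  induction k with
  | zero => simp [pr, expect]
  | succ k ih =>
    rw [pr_succ]
    simp only [List.replicate_succ, List.cons.injEq, true_and, reduceCtorEq, false_and, ih]
    simp [pr, expect_const, pow_succ']

theorem startsOnes_replicate_append (k : ℕ) (v : List Bool) :
    StartsOnes k (List.replicate k true ++ v) := fun j hj => by
  rw [List.getElem?_append_left (by simpa using hj)]
  simp [hj]

theorem eq_replicate_of_startsOnes {u v : List Bool} (h : StartsOnes k (u ++ v))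
    (hu : u.length = k) : u = List.replicate k true := by
  subst hu
  refine List.eq_replicate_iff.2 ⟨rfl, fun b hb => ?_⟩
  obtain ⟨i, hi, rfl⟩ := List.mem_iff_getElem.1 hb
  have := h i hi
  rw [List.getElem?_append_left hi, List.getElem?_eq_getElem hi] at this
  simpa using this

theorem pr_startsOnes_le (h0 : 0 ≤ p) (h1 : p ≤ 1) (k n : ℕ) :
    pr p (k + n) (StartsOnes k) ≤ p ^ k := by
  rw [← pr_ones p k, ← mul_one (pr p k _), ← pr_true p n]
  exact pr_append_le h0 h1 fun u v hu _ h => ⟨eq_replicate_of_startsOnes h hu, trivial⟩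

theorem le_pr_startsOnes (h0 : 0 ≤ p) (h1 : p ≤ 1) (k n : ℕ) :
    p ^ k ≤ pr p (k + n) (StartsOnes k) := by
  rw [← pr_ones p k, ← mul_one (pr p k _), ← pr_true p n]
  refine le_pr_append h0 h1 fun u v _ _ h _ => ?_
  rw [h]
  exact startsOnes_replicate_append k v

theorem pr_tail (p : ℝ) (n : ℕ) (A : List Bool → Prop) :
    pr p (n + 1) (fun w => A w.tail) = pr p n A := by
  rw [pr_succ]
  simp only [List.tail_cons]
  ring

theorem pr_startsOnes_le' (h0 : 0 ≤ p) (h1 : p ≤ 1) (hk : 0 < k) (n : ℕ) :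
    pr p n (StartsOnes k) ≤ p ^ k := by
  rcases le_or_gt k n with h | h
  · obtain ⟨m, rfl⟩ := Nat.exists_eq_add_of_le h
    exact pr_startsOnes_le h0 h1 k m
  · have : pr p n (StartsOnes k) = pr p n fun _ => False := by
      refine pr_congr h0 h1 fun w hw => iff_false_intro fun hs => ?_
      have := hs (k - 1) (by omega)
      rw [List.getElem?_eq_none (by omega)] at this
      exact absurd this (by simp)
    rw [this]
    simp only [pr, if_false, expect_const]
    positivity

theorem noBlock_antitone (h0 : 0 ≤ p) (h1 : p ≤ 1) : Antitone (noBlock k p) := by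
  refine antitone_nat_of_succ_le fun n => ?_
  refine (pr_mono h0 h1 (B := fun w => ¬ HasBlock k w.tail) fun w hw h hb => h ?_).trans_eq
    (pr_tail p n fun w => ¬ HasBlock k w)
  obtain ⟨b, w, rfl⟩ := List.exists_cons_of_length_eq_add_one hw
  exact hasBlock_cons.2 (Or.inr hb)

/-- Not starting with a run and having no block in the tail are both decreasing events, so Harris's
inequality supplies a factor `1 - p ^ k` per letter. -/
theorem le_noBlock (h0 : 0 ≤ p) (h1 : p ≤ 1) (hk : 0 < k) (n : ℕ) :
    (1 - p ^ k) ^ n ≤ noBlock k p n := by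
  induction n with
  | zero =>
    have : ∀ i j : ℕ, ([] : List Bool)[i + j]? ≠ some true := by simp
    simp only [pow_zero, noBlock, pr, expect]
    rw [if_pos]
    rintro ⟨i, hi⟩
    exact this i 0 (hi 0 hk)
  | succ n ih =>
    have hp : 0 ≤ 1 - p ^ k := sub_nonneg.2 (pow_le_one₀ h0 h1)
    have h2 : 1 - p ^ k ≤ pr p (n + 1) fun w => ¬ StartsOnes k w := by
      rw [pr_not]
      exact sub_le_sub_left (pr_startsOnes_le' h0 h1 hk _) 1
    have h3 : noBlock k p n = pr p (n + 1) fun w => ¬ HasBlock k w.tail := (pr_tail p n _).symm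
    calc (1 - p ^ k) ^ (n + 1) = (1 - p ^ k) * (1 - p ^ k) ^ n := pow_succ' _ _
      _ ≤ (pr p (n + 1) fun w => ¬ StartsOnes k w) * pr p (n + 1) fun w => ¬ HasBlock k w.tail :=
          mul_le_mul h2 (ih.trans_eq h3) (pow_nonneg hp n) (pr_nonneg h0 h1 _ _)
      _ ≤ pr p (n + 1) fun w => ¬ StartsOnes k w ∧ ¬ HasBlock k w.tail := by
          refine pr_mul_le h0 h1 _ (fun u v h hv hu => hv (hu.of_le h))
            (fun u v h hv hu => hv (HasBlock.of_le ?_ hu))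
          cases h with
          | nil => exact List.Forall₂.nil
          | cons _ h => exact h
      _ ≤ noBlock k p (n + 1) := by
          refine pr_mono h0 h1 fun w hw h hb => ?_
          obtain ⟨b, w, rfl⟩ := List.exists_cons_of_length_eq_add_one hw
          exact (hasBlock_cons.1 hb).elim h.1 h.2

/-- Only `k - 1` letters precede the separating `false` in the tail, so a block would have to lie in
`u`. -/
theorem not_hasBlock_tail {u : List Bool} (hu : ¬ HasBlock k u) :
    ¬ HasBlock k (List.replicate k true ++ ([false] ++ u)).tail := by
  rintro ⟨i, hi⟩
  refine hu ⟨i - k, fun j hj => ?_⟩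
  simp only [List.getElem?_tail] at hi
  have hik : k ≤ i := by
    by_contra hlt
    have := hi (k - 1 - i) (by omega)
    rw [show i + (k - 1 - i) + 1 = k by omega,
      List.getElem?_append_right (by simp)] at this
    simp at this
  have := hi j hj
  rw [List.getElem?_append_right (by simp; omega), List.getElem?_append_right (by simp; omega),
    List.length_replicate] at this
  rw [← this]
  congr 1
  simp only [List.length_singleton]
  omega

/-- Words `true ^ k`, `false`, `u` with no block in `u` lose their only block when the first letter
goes. They account for at least `p ^ k * (1 - p) * noBlock k p n` of the drop, and `noBlock` is
antitone. -/
theorem noBlock_succ_le (h0 : 0 ≤ p) (h1 : p ≤ 1) (hk : 0 < k) (n : ℕ) :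
    noBlock k p (k + n + 1) ≤ (1 - p ^ k * (1 - p)) * noBlock k p (k + n) := by
  have hfalse : pr p 1 (fun w => w = [false]) = 1 - p := by simp [pr, expect]
  have h2 : p ^ k * ((1 - p) * noBlock k p n) ≤ pr p (k + (1 + n)) fun w =>
      ∃ u, w = List.replicate k true ++ ([false] ++ u) ∧ ¬ HasBlock k u := by
    have h3 : (1 - p) * noBlock k p n ≤ pr p (1 + n) fun w => ∃ u, w = [false] ++ u ∧
        ¬ HasBlock k u := by
      rw [← hfalse]
      exact le_pr_append h0 h1 fun u v _ _ hu hv => ⟨v, by rw [hu], hv⟩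
    refine (mul_le_mul_of_nonneg_left h3 (pow_nonneg h0 k)).trans ?_
    rw [← pr_ones p k]
    refine le_pr_append h0 h1 fun u v _ _ hu => ?_
    rintro ⟨v, rfl, hv⟩
    exact ⟨v, by rw [hu], hv⟩
  have h4 : noBlock k p (k + n + 1) + (pr p (k + n + 1) fun w =>
      ∃ u, w = List.replicate k true ++ ([false] ++ u) ∧ ¬ HasBlock k u) ≤
      noBlock k p (k + n) := by
    have h5 : noBlock k p (k + n) = pr p (k + n + 1) fun w => ¬ HasBlock k w.tail :=
      (pr_tail p _ _).symm
    rw [h5, noBlock]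
    refine pr_add_le h0 h1 fun w hw => ?_
    have h6 : ¬ HasBlock k w → ¬ HasBlock k w.tail := fun h hb => h <| by
      obtain ⟨b, w, rfl⟩ := List.exists_cons_of_length_eq_add_one hw
      exact hasBlock_cons.2 (Or.inr hb)
    have h7 : (∃ u, w = List.replicate k true ++ ([false] ++ u) ∧ ¬ HasBlock k u) →
        HasBlock k w ∧ ¬ HasBlock k w.tail := by
      rintro ⟨u, rfl, hu⟩
      refine ⟨⟨0, fun j hj => ?_⟩, not_hasBlock_tail hu⟩
      rw [zero_add]
      exact startsOnes_replicate_append k _ j hj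
    exact ⟨h6, fun h => (h7 h).2, fun h h' => h (h7 h').1⟩
  rw [show k + (1 + n) = k + n + 1 by ring] at h2
  have h8 : noBlock k p (k + n) ≤ noBlock k p n := noBlock_antitone h0 h1 (by omega)
  have h9 : 0 ≤ p ^ k * (1 - p) := mul_nonneg (pow_nonneg h0 k) (sub_nonneg.2 h1)
  nlinarith [mul_le_mul_of_nonneg_left h8 h9]

theorem noBlock_le (h0 : 0 ≤ p) (h1 : p ≤ 1) (hk : 0 < k) (n : ℕ) :
    noBlock k p (k + n) ≤ (1 - p ^ k * (1 - p)) ^ n := by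
  induction n with
  | zero => exact (pr_le_one h0 h1 _ _).trans_eq (pow_zero _).symm
  | succ n ih =>
    have h2 : 0 ≤ 1 - p ^ k * (1 - p) := by
      have := pow_le_one₀ h0 h1 (n := k)
      have := pow_nonneg h0 k
      nlinarith
    rw [pow_succ']
    exact (noBlock_succ_le h0 h1 hk n).trans (mul_le_mul_of_nonneg_left ih h2)

theorem HasBlock.circRun (hk : 0 < k) {w : List Bool} : HasBlock k w → CircRun k w := by
  rintro ⟨i, hi⟩
  have hlt : ∀ j < k, i + j < w.length := fun j hj => by
    by_contra h
    have := hi j hj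
    rw [List.getElem?_eq_none (by omega)] at this
    exact absurd this (by simp)
  refine ⟨i, hlt 0 hk, fun j hj => ?_⟩
  rw [Nat.mod_eq_of_lt (hlt j hj)]
  exact hi j hj

/-- A run passing the end of the word has `s` letters at its end and `k - s` at its start; `k ≤
w.length` keeps these parts disjoint. -/
theorem CircRun.hasBlock_or {w : List Bool} (hkw : k ≤ w.length) (h : CircRun k w) :
    HasBlock k w ∨ ∃ s ∈ Finset.range k, ∃ u, w =
      List.replicate (k - s) true ++ (u ++ List.replicate s true) := by
  obtain ⟨i, hi, h⟩ := h
  rcases le_or_gt (i + k) w.length with h2 | h2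
  · refine Or.inl ⟨i, fun j hj => ?_⟩
    have := h j hj
    rwa [Nat.mod_eq_of_lt (by omega)] at this
  · right
    refine ⟨w.length - i, Finset.mem_range.2 (by omega),
      (w.drop (k - (w.length - i))).take (i - (k - (w.length - i))), ?_⟩
    have h3 : StartsOnes (k - (w.length - i)) w := fun j hj => by
      have := h (j + (w.length - i)) (by omega)
      rwa [show i + (j + (w.length - i)) = j + w.length by omega, Nat.add_mod_right,
        Nat.mod_eq_of_lt (by omega)] at this
    have h4 : w.drop i = List.replicate (w.length - i) true := by
      refine eq_replicate_of_startsOnes (v := []) (fun j hj => ?_) (by simp)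
      have := h j (by omega)
      rw [Nat.mod_eq_of_lt (by omega)] at this
      simpa using this
    have h5 : w.take (k - (w.length - i)) = List.replicate (k - (w.length - i)) true := by
      refine eq_replicate_of_startsOnes (v := w.drop (k - (w.length - i))) ?_ (by simp; omega)
      rwa [List.take_append_drop]
    rw [← h4, ← h5]
    conv_lhs => rw [← List.take_append_drop (k - (w.length - i)) w]
    congr 1
    conv_lhs => rw [← List.take_append_drop (i - (k - (w.length - i)))
      (w.drop (k - (w.length - i)))]
    rw [List.drop_drop]
    congr 2
    omega

theorem pr_not_circRun_le (h0 : 0 ≤ p) (h1 : p ≤ 1) (hk : 0 < k) (n : ℕ) :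
    pr p (k + n) (fun w => ¬ CircRun k w) ≤ Real.exp (-(p ^ k * (1 - p) * n)) := by
  calc pr p (k + n) (fun w => ¬ CircRun k w) ≤ noBlock k p (k + n) :=
        pr_mono h0 h1 fun w _ h hb => h (hb.circRun hk)
    _ ≤ (1 - p ^ k * (1 - p)) ^ n := noBlock_le h0 h1 hk n
    _ ≤ Real.exp (-(p ^ k * (1 - p))) ^ n := by
        refine pow_le_pow_left₀ ?_ ?_ n
        · have := pow_le_one₀ h0 h1 (n := k)
          have := pow_nonneg h0 k
          nlinarith
        · linarith [Real.add_one_le_exp (-(p ^ k * (1 - p)))]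
    _ = _ := by rw [← Real.exp_nat_mul]; ring_nf

/-- Circular runs differ from blocks only by the wrapping ones, which cost at most `p ^ k` for each
of `k` splittings. -/
theorem le_pr_not_circRun (h0 : 0 ≤ p) (h1 : p < 1) (hk : 0 < k) (n : ℕ) :
    Real.exp (-(p ^ k * (k + n : ℕ) / (1 - p ^ k))) - k * p ^ k ≤
      pr p (k + n) (fun w => ¬ CircRun k w) := by
  have hlt : p ^ k < 1 := pow_lt_one₀ h0 h1 hk.ne'
  have hwrap : ∀ s ∈ Finset.range k, pr p (k + n) (fun w => ∃ u, w =
      List.replicate (k - s) true ++ (u ++ List.replicate s true)) ≤ p ^ k := by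
    intro s hs
    have hs' := Finset.mem_range.1 hs
    calc _ ≤ p ^ (k - s) * (1 * p ^ s) := ?_
      _ = p ^ k := by rw [one_mul, ← pow_add]; congr 1; omega
    rw [show k + n = (k - s) + (n + s) by omega, ← pr_ones p (k - s), ← pr_ones p s,
      ← pr_true p n]
    refine (pr_append_le h0 h1.le (B := fun w => w = List.replicate (k - s) true)
      (C := fun w => ∃ u, w = u ++ List.replicate s true) ?_).trans
        (mul_le_mul_of_nonneg_left (pr_append_le h0 h1.le ?_) (pr_nonneg h0 h1.le _ _))
    · rintro u v hu _ ⟨u', h⟩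
      obtain ⟨h2, h3⟩ := List.append_inj h (by simpa using hu)
      exact ⟨h2, u', h3⟩
    · rintro u v _ hv ⟨u', h⟩
      exact ⟨trivial, (List.append_inj' h (by simpa using hv)).2⟩
  have h2 : noBlock k p (k + n) ≤ pr p (k + n) (fun w => ¬ CircRun k w) + k * p ^ k := by
    refine (pr_mono h0 h1.le (B := fun w => ¬ CircRun k w ∨ ∃ s ∈ Finset.range k, ∃ u, w =
      List.replicate (k - s) true ++ (u ++ List.replicate s true)) ?_).trans
      ((pr_or_le h0 h1.le _ _ _).trans (add_le_add_right
        ((pr_exists_le h0 h1.le _ _ _).trans ?_) _))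
    · intro w hw hb
      by_contra hc
      rw [not_or, not_not] at hc
      exact (hc.1.hasBlock_or (by omega)).elim hb hc.2
    · simpa using Finset.sum_le_card_nsmul _ _ _ hwrap
  have h3 : Real.exp (-(p ^ k * (k + n : ℕ) / (1 - p ^ k))) ≤ (1 - p ^ k) ^ (k + n) := by
    have hpos : 0 < 1 - p ^ k := sub_pos.2 hlt
    -- This is `1 + t ≤ exp t` at `t = r / (1 - r)` with `r = p ^ k`, inverted.
    have h4 : Real.exp (-(p ^ k / (1 - p ^ k))) ≤ 1 - p ^ k := by
      rw [Real.exp_neg, inv_le_comm₀ (Real.exp_pos _) hpos]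
      refine le_trans (le_of_eq ?_) (Real.add_one_le_exp _)
      field_simp
      ring
    calc _ = Real.exp (-(p ^ k / (1 - p ^ k))) ^ (k + n) := by
          rw [← Real.exp_nat_mul]; congr 1; ring
      _ ≤ _ := pow_le_pow_left₀ (Real.exp_pos _).le h4 _
  linarith [le_noBlock h0 h1.le hk (k + n)]

end Runs

/-! ### Run sentences and the recognizing monoid -/

section Sentences

open FirstOrder.Language

/-- The atomic formula stating that a variable satisfies the unary predicate, or its negation. -/
def literal {k : ℕ} (b : Bool) (i : Fin k) : circular.BoundedFormula Empty k :=
  let φ : circular.BoundedFormula Empty k :=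
    BoundedFormula.rel (show circular.Relations 1 from Rel.U) fun _ => Term.var (Sum.inr i)
  if b then φ else φ.not

/-- The formula stating that a variable is the successor of another one, on a cycle with at least
two elements. -/
def successor {k : ℕ} (i j : Fin k) : circular.BoundedFormula Empty k :=
  (BoundedFormula.equal (Term.var (Sum.inr i)) (Term.var (Sum.inr j))).not ⊓
    BoundedFormula.all (BoundedFormula.not (BoundedFormula.rel
      (show circular.Relations 3 from Rel.C) fun l => Term.var (Sum.inr
        ((![i.castSucc, Fin.last k, j.castSucc] : Fin 3 → Fin (k + 1)) l))))

/-- The sentence stating that some `k` consecutive elements satisfy the unary predicate, or that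
they all do not satisfy it. -/
noncomputable def runSentence (k : ℕ) (b : Bool) : circular.Sentence :=
  ((BoundedFormula.iInf fun i : Fin k => literal b i) ⊓
    BoundedFormula.iInf fun ij : {ij : Fin k × Fin k // (ij.2 : ℕ) = ij.1 + 1} =>
      successor ij.1.1 ij.1.2).exs

theorem realize_literal {k n : ℕ} {U : Set (Fin n)} {b : Bool} {i : Fin k} {e : Empty → Fin n}
    {x : Fin k → Fin n} : (letI := model n U; (literal b i).Realize e x) ↔
      (x i ∈ U ↔ b = true) := by
  cases b
  · exact (show _ ↔ ¬ x i ∈ U from Iff.rfl).trans (by simp)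
  · exact (show _ ↔ x i ∈ U from Iff.rfl).trans (by simp)

theorem realize_successor {k n : ℕ} {U : Set (Fin n)} {i j : Fin k} {e : Empty → Fin n}
    {x : Fin k → Fin n} : (letI := model n U; (successor i j).Realize e x) ↔
      x i ≠ x j ∧ ∀ z, ¬ Clockwise (x i) z (x j) := by
  let _ := model n U
  rw [successor, BoundedFormula.realize_inf, BoundedFormula.realize_not]
  refine and_congr Iff.rfl (forall_congr' fun z => not_congr ?_)
  change Clockwise ((Fin.snoc x z : Fin (k + 1) → Fin n) i.castSucc)
    ((Fin.snoc x z : Fin (k + 1) → Fin n) (Fin.last k))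
    ((Fin.snoc x z : Fin (k + 1) → Fin n) j.castSucc) ↔ _
  rw [Fin.snoc_castSucc, Fin.snoc_castSucc, Fin.snoc_last]

theorem holds_runSentence_iff {k n : ℕ} {U : Set (Fin n)} {b : Bool} :
    Holds n U (runSentence k b) ↔ ∃ x : Fin k → Fin n, (∀ i, x i ∈ U ↔ b = true) ∧
      ∀ i j : Fin k, (j : ℕ) = i + 1 → x i ≠ x j ∧ ∀ z, ¬ Clockwise (x i) z (x j) := by
  let _ := model n U
  refine BoundedFormula.realize_exs.trans (exists_congr fun x => ?_)
  rw [BoundedFormula.realize_inf, BoundedFormula.realize_iInf, BoundedFormula.realize_iInf]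
  refine and_congr (forall_congr' fun i => realize_literal) ?_
  simp only [Subtype.forall, Prod.forall]
  exact forall₃_congr fun i j _ => realize_successor

/-- If `y` is not the next element after `x`, that element witnesses betweenness, unless `y = x`.
For `n = 1` the point would be its own successor, hence `2 ≤ n`. -/
theorem isSuccessor_iff {n : ℕ} (hn : 2 ≤ n) (x y : Fin n) :
    (x ≠ y ∧ ∀ z, ¬ Clockwise x z y) ↔ (y : ℕ) = (x + 1) % n := by
  have hx := x.2
  have hy := y.2
  constructor
  · rintro ⟨hxy, h⟩
    have hxy' : (x : ℕ) ≠ y := fun h => hxy (Fin.ext h)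
    by_contra hne
    refine h ⟨(x + 1) % n, Nat.mod_lt _ (by omega)⟩ ?_
    simp only [Clockwise, Fin.lt_def]
    rcases eq_or_ne ((x : ℕ) + 1) n with h2 | h2
    · rw [h2, Nat.mod_self] at hne ⊢
      omega
    · rw [Nat.mod_eq_of_lt (by omega)] at hne ⊢
      omega
  · intro h
    refine ⟨fun hxy => ?_, fun z hz => ?_⟩
    · have hxy' : (x : ℕ) = y := congrArg Fin.val hxy
      rcases eq_or_ne ((x : ℕ) + 1) n with h2 | h2
      · rw [h2, Nat.mod_self] at h
        omega
      · rw [Nat.mod_eq_of_lt (by omega)] at h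
        omega
    · have hz' := z.2
      simp only [Clockwise, Fin.lt_def] at hz
      rcases eq_or_ne ((x : ℕ) + 1) n with h2 | h2
      · rw [h2, Nat.mod_self] at h
        omega
      · rw [Nat.mod_eq_of_lt (by omega)] at h
        omega

theorem holds_runSentence {k n : ℕ} (hk : 0 < k) (hn : k ≤ n) {U : Set (Fin n)} {b : Bool} :
    Holds n U (runSentence k b) ↔ HasRun k n {x | x ∈ U ↔ b = true} := by
  rw [holds_runSentence_iff]
  constructor
  · rintro ⟨x, hx, hs⟩
    have hval : ∀ j (hj : j < k), (x ⟨j, hj⟩ : ℕ) = (x ⟨0, hk⟩ + j) % n := by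
      intro j
      induction j with
      | zero => intro hj; rw [add_zero, Nat.mod_eq_of_lt (Fin.is_lt _)]
      | succ j ih =>
        intro hj
        have h2 := (isSuccessor_iff (by omega) _ _).1 (hs ⟨j, by omega⟩ ⟨j + 1, hj⟩ rfl)
        rw [h2, ih, Nat.mod_add_mod, add_assoc]
    refine ⟨x ⟨0, hk⟩, fun j hj => ?_⟩
    rw [show (⟨(x ⟨0, hk⟩ + j) % n, Nat.mod_lt _ (x ⟨0, hk⟩).pos⟩ : Fin n) = x ⟨j, hj⟩ from
      Fin.ext (hval j hj).symm]
    exact hx _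
  · rintro ⟨i, hi⟩
    refine ⟨fun j => ⟨(i + j) % n, Nat.mod_lt _ i.pos⟩, fun j => hi j j.2, fun j j' hj => ?_⟩
    rw [isSuccessor_iff (by have := j'.2; omega)]
    simp only [hj, Nat.mod_add_mod, add_assoc]

theorem circRun_iff_hasRun {k : ℕ} {w : List Bool} :
    HasRun k w.length (wordSet w) ↔ CircRun k w := by
  constructor
  · rintro ⟨i, hi⟩
    refine ⟨i, i.2, fun j hj => ?_⟩
    have := hi j hj
    rw [List.getElem?_eq_getElem (Nat.mod_lt _ i.pos)]
    exact congrArg some this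
  · rintro ⟨i, hi, h⟩
    refine ⟨⟨i, hi⟩, fun j hj => ?_⟩
    have := h j hj
    rw [List.getElem?_eq_getElem (Nat.mod_lt _ (by omega))] at this
    exact Option.some.inj this

theorem circRun_map_not_iff_hasRun {k : ℕ} {w : List Bool} :
    HasRun k w.length {x | x ∈ wordSet w ↔ false = true} ↔ CircRun k (w.map not) := by
  simp only [CircRun, HasRun, List.length_map, List.getElem?_map]
  constructor
  · rintro ⟨i, hi⟩
    refine ⟨i, i.2, fun j hj => ?_⟩
    have := hi j hj
    rw [List.getElem?_eq_getElem (Nat.mod_lt _ i.pos)]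
    simpa [wordSet] using this
  · rintro ⟨i, hi, h⟩
    refine ⟨⟨i, hi⟩, fun j hj => ?_⟩
    have := h j hj
    rw [List.getElem?_eq_getElem (Nat.mod_lt _ (by omega))] at this
    simpa [wordSet] using this

theorem pr_map_not (p : ℝ) (n : ℕ) (A : List Bool → Prop) :
    pr p n (fun w => A (w.map not)) = pr (1 - p) n A := by
  induction n generalizing A with
  | zero => rfl
  | succ n ih =>
    rw [pr_succ, pr_succ]
    simp only [List.map_cons, Bool.not_true, Bool.not_false]
    rw [ih fun w => A (true :: w), ih fun w => A (false :: w)]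
    ring

theorem prob_runSentence_true {k n : ℕ} (hk : 0 < k) (hn : k ≤ n) (p : unitInterval) :
    prob n p (runSentence k true) = pr p n (CircRun k) := by
  rw [prob_eq_pr]
  refine pr_congr p.2.1 p.2.2 fun w hw => ?_
  rw [holds_runSentence hk (hn.trans_eq hw.symm), ← circRun_iff_hasRun]
  simp

theorem prob_runSentence_false {k n : ℕ} (hk : 0 < k) (hn : k ≤ n) (p : unitInterval) :
    prob n p (runSentence k false) = pr (1 - p) n (CircRun k) := by
  rw [prob_eq_pr, ← pr_map_not]
  refine pr_congr p.2.1 p.2.2 fun w hw => ?_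
  rw [holds_runSentence hk (hn.trans_eq hw.symm), ← circRun_map_not_iff_hasRun]

/-- The truth of a sentence is recognized by a finite aperiodic monoid. -/
theorem exists_recognizer (S : circular.Sentence) :
    ∃ (M : Type) (_ : Monoid M) (_ : Finite M) (N : ℕ) (φ : List Bool → M), N ≠ 0 ∧
      (∀ x : M, x ^ (N + 1) = x ^ N) ∧ (∀ u v, φ (u ++ v) = φ u * φ v) ∧ φ [] = 1 ∧
      Function.Surjective φ ∧ ∀ w w', φ w = φ w' →
        (Holds w.length (wordSet w) S ↔ Holds w'.length (wordSet w') S) := by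
  obtain ⟨q, hq⟩ := exists_rank S
  -- The monoid is the free monoid modulo equality of rank `q` types, with aperiodicity exponent `2
  -- ^ q`.
  let c : Con (FreeMonoid Bool) :=
    { r := fun u v => wordType q u.toList = wordType q v.toList
      iseqv := ⟨fun _ => rfl, fun h => h.symm, fun h h' => h.trans h'⟩
      mul' := fun h h' => wordType_append h h' }
  have hc : ∀ u v : FreeMonoid Bool, (c.mk' u = c.mk' v) ↔
      wordType q u.toList = wordType q v.toList := fun u v => c.eq
  have hfin : Finite c.Quotient := by
    refine Finite.of_injective (β := WordType Bool q)
      (fun x => Con.liftOn x (fun u => wordType q u.toList) fun _ _ h => h) ?_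
    intro x y
    refine Con.induction_on₂ x y fun u v h => ?_
    exact (hc u v).2 h
  have hpow : ∀ (u : FreeMonoid Bool) (n : ℕ), (u ^ n).toList = wordPow u.toList n := by
    intro u n
    induction n with
    | zero => rfl
    | succ n ih => rw [pow_succ', FreeMonoid.toList_mul, ih, wordPow_succ]
  refine ⟨c.Quotient, inferInstance, hfin, 2 ^ q, fun w => c.mk' (FreeMonoid.ofList w),
    by positivity, fun x => ?_, fun u v => ?_, rfl, fun x => ?_, fun w w' h => ?_⟩
  · refine Con.induction_on x fun u => ?_
    change c.mk' u ^ _ = c.mk' u ^ _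
    rw [← map_pow, ← map_pow, hc, hpow, hpow]
    exact wordType_wordPow _ (by omega) (by omega)
  · exact map_mul c.mk' (FreeMonoid.ofList u) (FreeMonoid.ofList v)
  · refine Con.induction_on x fun u => ?_
    exact ⟨u.toList, rfl⟩
  · exact hq w w' ((hc _ _).1 h)

end Sentences

/-! ### Sufficiency of the five ranges -/

section Favourable

/-- The ranges of probabilities `p` with a zero-one law in which `p` is not close to one. -/
def Favourable (p : ℕ → ℝ) : Prop :=
  Tendsto (fun n : ℕ => n * p n) atTop (𝓝 0) ∨
  (∃ k : ℕ, Tendsto p atTop (𝓝[>] 0) ∧ Tendsto (fun n : ℕ => n * p n ^ k) atTop atTop ∧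
    Tendsto (fun n : ℕ => n * p n ^ (k + 1)) atTop (𝓝 0)) ∨
  ∀ L : ℕ, Tendsto (fun n : ℕ => n * (p n * (1 - p n)) ^ L) atTop atTop

theorem pr_zeros (p : ℝ) (n : ℕ) : pr p n (fun w => w = List.replicate n false) = (1 - p) ^ n := by
  have := pr_ones (1 - p) n
  rw [← pr_map_not] at this
  rw [← this]
  refine congrArg (pr p n) (funext fun w => propext ⟨?_, fun h => ?_⟩)
  · rintro rfl
    simp
  · simpa [Function.comp_def] using congrArg (List.map not) h

theorem Favourable.tendsto {M : Type*} [Monoid M] [Finite M] {N : ℕ} {φ : List Bool → M}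
    {p : ℕ → ℝ} (hp : Favourable p) (hN0 : N ≠ 0) (hN : ∀ x : M, x ^ (N + 1) = x ^ N)
    (hmul : ∀ u v, φ (u ++ v) = φ u * φ v) (hone : φ [] = 1) (hsurj : Function.Surjective φ)
    (h0 : ∀ n, 0 ≤ p n) (h1 : ∀ n, p n ≤ 1) {H : List Bool → Prop}
    (hH : ∀ u v, φ u = φ v → (H u ↔ H v)) (hcirc : ∀ u v, H (u ++ v) ↔ H (v ++ u)) :
    Tendsto (fun n => pr (p n) n H) atTop (𝓝 0) ∨
      Tendsto (fun n => pr (p n) n H) atTop (𝓝 1) := by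
  rcases hp with hp | ⟨k, hp, hk, hk'⟩ | hp
  -- If `n * p n → 0`, Bernoulli's inequality makes the word all `false` with probability tending to
  -- one, and aperiodicity makes `φ` constant on long such words.
  · have hrep : ∀ n, φ (List.replicate n false) = φ [false] ^ n := by
      intro n
      induction n with
      | zero => simpa using hone
      | succ n ih => rw [List.replicate_succ', hmul, ih, pow_succ]
    have hpow : ∀ n, N ≤ n → φ (List.replicate n false) = φ (List.replicate N false) := by
      intro n hn
      rw [hrep, hrep]
      induction hn with
      | refl => rfl
      | @step m hm ih =>
        obtain ⟨j, rfl⟩ := Nat.exists_eq_add_of_le hm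
        rw [Nat.succ_eq_add_one, show N + j + 1 = N + 1 + j by ring, pow_add, hN, ← pow_add, ih]
    have hbad : ∀ A : List Bool → Prop, (∀ n, N ≤ n → ¬ A (List.replicate n false)) →
        Tendsto (fun n => pr (p n) n A) atTop (𝓝 0) := by
      intro A hA
      refine squeeze_zero' (Eventually.of_forall fun n => pr_nonneg (h0 n) (h1 n) _ _) ?_ hp
      filter_upwards [eventually_ge_atTop N] with n hn
      refine (pr_mono (h0 n) (h1 n) (B := fun w => ¬ w = List.replicate n false) ?_).trans ?_
      · rintro w _ hw rfl
        exact hA n hn hw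
      · rw [pr_not, pr_zeros]
        have := one_add_mul_le_pow (a := -p n) (by linarith [h1 n]) n
        rw [← sub_eq_add_neg] at this
        linarith
    by_cases hz : H (List.replicate N false)
    · right
      have := hbad (fun w => ¬ H w) fun n hn => not_not.2 ((hH _ _ (hpow n hn)).2 hz)
      simp only [pr_not] at this
      simpa using (tendsto_const_nhds (x := (1 : ℝ))).sub this
    · left
      exact hbad H fun n hn h => hz ((hH _ _ (hpow n hn)).1 h)
  · exact tendsto_zero_or_one_of_ideals hN hN0 hmul hsurj h0 h1
      (ideal_dichotomy_of_window hmul hone hsurj h0 h1 hp hk hk') hH hcirc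
  · exact tendsto_zero_or_one_of_ideals hN hN0 hmul hsurj h0 h1
      (fun x => Or.inl fun m hm => ideal_hit_of_rich hmul hsurj h0 h1 hp x hm) hH hcirc

theorem zeroOneLaw_of_favourable {p : ℕ → unitInterval} (hp : Favourable fun n => p n) :
    ZeroOneLaw p := by
  intro S
  obtain ⟨M, _, _, N, φ, hN0, hN, hmul, hone, hsurj, hφ⟩ := exists_recognizer S
  simp only [prob_eq_pr]
  exact hp.tendsto hN0 hN hmul hone hsurj (fun n => (p n).2.1) (fun n => (p n).2.2) hφ
    fun u v => holds_append_comm u v S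

/-- Negating all letters exchanges `p` and `1 - p`, and `φ` composed with the negation is still a
surjective morphism. -/
theorem zeroOneLaw_of_favourable_compl {p : ℕ → unitInterval}
    (hp : Favourable fun n => 1 - (p n : ℝ)) : ZeroOneLaw p := by
  intro S
  obtain ⟨M, _, _, N, φ, hN0, hN, hmul, hone, hsurj, hφ⟩ := exists_recognizer S
  have hnot : ∀ w : List Bool, (w.map not).map not = w := fun w => by simp [Function.comp_def]
  have h2 : ∀ n, prob n (p n) S = pr (1 - (p n : ℝ)) n fun w =>
      Holds (w.map not).length (wordSet (w.map not)) S := fun n => by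
    rw [prob_eq_pr, ← pr_map_not]
    refine congrArg (pr (p n) n) (funext fun w => ?_)
    rw [hnot]
  simp only [h2]
  exact hp.tendsto (φ := fun w => φ (w.map not)) hN0 hN
    (fun u v => by rw [List.map_append, hmul]) hone
    (fun x => by
      obtain ⟨w, rfl⟩ := hsurj x
      exact ⟨w.map not, congrArg φ (hnot w)⟩)
    (fun n => sub_nonneg.2 (p n).2.2) (fun n => by linarith [(p n).2.1])
    (fun u v h => hφ _ _ h)
    fun u v => by rw [List.map_append, List.map_append]; exact holds_append_comm _ _ S

end Favourable

/-! ### Growth conditions in terms of `n * p n ^ k` -/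

section Asymptotics

variable {p : ℕ → ℝ} {k : ℕ}

theorem rpow_neg_inv_pow (hk : 0 < k) (n : ℕ) : ((n : ℝ) ^ (-(1 / (k : ℝ)))) ^ k = (n : ℝ)⁻¹ := by
  have hk' : (k : ℝ) ≠ 0 := by positivity
  rw [← Real.rpow_natCast, ← Real.rpow_mul (Nat.cast_nonneg n), neg_mul, one_div,
    inv_mul_cancel₀ hk', Real.rpow_neg_one]

theorem div_rpow_neg_inv_pow (hk : 0 < k) (x : ℝ) (n : ℕ) :
    (x / (n : ℝ) ^ (-(1 / (k : ℝ)))) ^ k = n * x ^ k := by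
  rw [div_pow, rpow_neg_inv_pow hk, div_inv_eq_mul, mul_comm]

theorem isLittleO_rpow_iff (hk : 0 < k) (h0 : ∀ n, 0 ≤ p n) :
    p =o[atTop] (fun n : ℕ => (n : ℝ) ^ (-(1 / (k : ℝ)))) ↔
      Tendsto (fun n : ℕ => n * p n ^ k) atTop (𝓝 0) := by
  constructor
  · intro h
    have := h.tendsto_div_nhds_zero.pow k
    simpa only [div_rpow_neg_inv_pow hk, zero_pow hk.ne'] using this
  · intro h
    refine isLittleO_of_tendsto' ?_ ?_
    · filter_upwards [eventually_gt_atTop 0] with n hn h2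
      exact absurd h2 (Real.rpow_pos_of_pos (by exact_mod_cast hn) _).ne'
    · have h2 := h.rpow_const (p := (k : ℝ)⁻¹) (Or.inr (by positivity))
      rw [Real.zero_rpow (by positivity)] at h2
      refine h2.congr fun n => ?_
      rw [← div_rpow_neg_inv_pow hk, Real.pow_rpow_inv_natCast _ hk.ne']
      have := h0 n
      positivity

theorem rpow_isLittleO_iff (hk : 0 < k) (h0 : ∀ n, 0 ≤ p n) :
    (fun n : ℕ => (n : ℝ) ^ (-(1 / (k : ℝ)))) =o[atTop] p ↔
      Tendsto (fun n : ℕ => n * p n ^ k) atTop atTop := by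
  have hinv : ∀ n : ℕ, ((n : ℝ) ^ (-(1 / (k : ℝ))) / p n) ^ k = (n * p n ^ k)⁻¹ := fun n => by
    rw [← div_rpow_neg_inv_pow hk, ← inv_pow, inv_div]
  constructor
  · intro h
    have h2 := h.tendsto_div_nhds_zero.pow k
    simp only [hinv, zero_pow hk.ne'] at h2
    have hpos : ∀ᶠ n : ℕ in atTop, 0 < (n * p n ^ k)⁻¹ := by
      filter_upwards [h.bound one_pos, eventually_gt_atTop 0] with n h3 hn
      have hn' : (0 : ℝ) < n := by exact_mod_cast hn
      have h4 := Real.rpow_pos_of_pos hn' (-(1 / (k : ℝ)))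
      rw [Real.norm_of_nonneg h4.le, Real.norm_of_nonneg (h0 n), one_mul] at h3
      have := h4.trans_le h3
      positivity
    have := (tendsto_nhdsWithin_iff.2 ⟨h2, hpos⟩).inv_tendsto_nhdsGT_zero
    simpa only [Pi.inv_def, inv_inv] using this
  · intro h
    refine isLittleO_of_tendsto' ?_ ?_
    · filter_upwards [h.eventually_gt_atTop 0] with n hn h2
      rw [h2, zero_pow hk.ne', mul_zero] at hn
      exact absurd hn (lt_irrefl _)
    · have h2 := h.inv_tendsto_atTop.rpow_const (p := (k : ℝ)⁻¹) (Or.inr (by positivity))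
      rw [Real.zero_rpow (by positivity)] at h2
      refine h2.congr fun n => ?_
      rw [Pi.inv_apply, ← hinv, Real.pow_rpow_inv_natCast _ hk.ne']
      have := h0 n
      positivity

/-- The exponents `1 / k` suffice: for `1 / (k + 1) < ε` the power `n ^ (-ε)` is below `n ^ (-(1 /
(k + 1)))`. -/
theorem forall_rpow_isLittleO_iff (h0 : ∀ n, 0 ≤ p n) :
    (∀ ε : ℝ, 0 < ε → (fun n : ℕ => (n : ℝ) ^ (-ε)) =o[atTop] p) ↔
      ∀ k : ℕ, 0 < k → Tendsto (fun n : ℕ => n * p n ^ k) atTop atTop := by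
  constructor
  · exact fun h k hk => (rpow_isLittleO_iff hk h0).1 (h _ (by positivity))
  · intro h ε hε
    obtain ⟨k, hk⟩ := exists_nat_one_div_lt hε
    refine IsBigO.trans_isLittleO (IsBigO.of_bound 1 ?_)
      ((rpow_isLittleO_iff k.succ_pos h0).2 (h _ k.succ_pos))
    filter_upwards [eventually_ge_atTop 1] with n hn
    have hn' : (1 : ℝ) ≤ n := by exact_mod_cast hn
    rw [one_mul, Real.norm_of_nonneg (by positivity), Real.norm_of_nonneg (by positivity)]
    refine Real.rpow_le_rpow_of_exponent_le hn' (neg_le_neg ?_)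
    push_cast
    exact hk.le

theorem tendsto_zero_of_mul_pow (hk : 0 < k) (h0 : ∀ n, 0 ≤ p n) {C : ℝ}
    (h : Tendsto (fun n : ℕ => n * p n ^ k) atTop (𝓝 C)) : Tendsto p atTop (𝓝 0) := by
  have h2 : Tendsto (fun n => p n ^ k) atTop (𝓝 0) := by
    have := h.mul tendsto_inv_atTop_nhds_zero_nat
    rw [mul_zero] at this
    refine this.congr' ?_
    filter_upwards [eventually_gt_atTop 0] with n hn
    have hn' : (n : ℝ) ≠ 0 := by positivity
    field_simp
  have h3 := h2.rpow_const (p := (k : ℝ)⁻¹) (Or.inr (by positivity))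
  rw [Real.zero_rpow (by positivity)] at h3
  exact h3.congr fun n => Real.pow_rpow_inv_natCast (h0 n) hk.ne'

end Asymptotics

/-! ### Limits of run probabilities and necessity -/

section RunLimits

variable {p : ℕ → ℝ} {k : ℕ}

theorem pr_not_circRun_le_exp {q : ℝ} (h0 : 0 ≤ q) (h1 : q ≤ 1) (hk : 0 < k) {n : ℕ}
    (hn : k ≤ n) :
    pr q n (fun w => ¬ CircRun k w) ≤ Real.exp (-((1 - q) * (n * q ^ k - k * q ^ k))) := by
  obtain ⟨m, rfl⟩ := Nat.exists_eq_add_of_le hn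
  refine (pr_not_circRun_le h0 h1 hk m).trans_eq ?_
  congr 2
  push_cast
  ring

theorem exp_le_pr_not_circRun {q : ℝ} (h0 : 0 ≤ q) (h1 : q < 1) (hk : 0 < k) {n : ℕ}
    (hn : k ≤ n) :
    Real.exp (-(n * q ^ k / (1 - q ^ k))) - k * q ^ k ≤ pr q n (fun w => ¬ CircRun k w) := by
  obtain ⟨m, rfl⟩ := Nat.exists_eq_add_of_le hn
  refine le_trans (le_of_eq ?_) (le_pr_not_circRun h0 h1 hk m)
  rw [mul_comm (q ^ k) ((k + m : ℕ) : ℝ)]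

theorem tendsto_pr_circRun (hk : 0 < k) (h0 : ∀ n, 0 ≤ p n) (h1 : ∀ n, p n ≤ 1) {C : ℝ}
    (h : Tendsto (fun n : ℕ => n * p n ^ k) atTop (𝓝 C)) :
    Tendsto (fun n => pr (p n) n (CircRun k)) atTop (𝓝 (1 - Real.exp (-C))) := by
  have hp := tendsto_zero_of_mul_pow hk h0 h
  have hpk : Tendsto (fun n => p n ^ k) atTop (𝓝 0) := by
    simpa only [zero_pow hk.ne'] using hp.pow k
  have hlt : ∀ᶠ n in atTop, p n < 1 := hp.eventually (Iio_mem_nhds one_pos)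
  have hkp : Tendsto (fun n => (k : ℝ) * p n ^ k) atTop (𝓝 0) := by
    simpa using hpk.const_mul (k : ℝ)
  have hlow : Tendsto (fun n : ℕ => Real.exp (-(n * p n ^ k / (1 - p n ^ k))) - k * p n ^ k) atTop
      (𝓝 (Real.exp (-C))) := by
    have h2 : Tendsto (fun n => 1 - p n ^ k) atTop (𝓝 1) := by simpa using hpk.const_sub 1
    have h3 := (Real.continuous_exp.tendsto _).comp (h.div h2 one_ne_zero).neg
    simpa using h3.sub hkp
  have hup : Tendsto (fun n : ℕ => Real.exp (-((1 - p n) * (n * p n ^ k - k * p n ^ k)))) atTop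
      (𝓝 (Real.exp (-C))) := by
    have h2 : Tendsto (fun n => 1 - p n) atTop (𝓝 1) := by simpa using hp.const_sub 1
    have h3 := (Real.continuous_exp.tendsto _).comp (h2.mul (h.sub hkp)).neg
    simpa [Function.comp_def] using h3
  have hlim : Tendsto (fun n => pr (p n) n fun w => ¬ CircRun k w) atTop (𝓝 (Real.exp (-C))) := by
    refine tendsto_of_tendsto_of_tendsto_of_le_of_le' hlow hup ?_ ?_
    · filter_upwards [hlt, eventually_ge_atTop k] with n h2 h3
      exact exp_le_pr_not_circRun (h0 n) h2 hk h3
    · filter_upwards [eventually_ge_atTop k] with n h3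
      exact pr_not_circRun_le_exp (h0 n) (h1 n) hk h3
  simp only [pr_not] at hlim
  simpa using hlim.const_sub 1

/-- While `n * p n ^ k < C` and `n` is large, `p n ^ k < 1 / 2`, so a run is absent with probability
at least `exp (-2 * C)` up to a vanishing error. The limit one excludes this. -/
theorem tendsto_mul_pow_atTop_of_pr_circRun (hk : 0 < k) (h0 : ∀ n, 0 ≤ p n) (h1 : ∀ n, p n ≤ 1)
    (h : Tendsto (fun n => pr (p n) n (CircRun k)) atTop (𝓝 1)) :
    Tendsto (fun n : ℕ => n * p n ^ k) atTop atTop := by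
  have h2 : Tendsto (fun n => pr (p n) n fun w => ¬ CircRun k w) atTop (𝓝 0) := by
    simpa [pr_not] using h.const_sub 1
  refine tendsto_atTop.2 fun C₀ => ?_
  obtain ⟨C, hC, hC0⟩ : ∃ C, C₀ ≤ C ∧ 0 < C := ⟨max C₀ 1, le_max_left _ _, by positivity⟩
  have hn0 : Tendsto (fun n : ℕ => C * (n : ℝ)⁻¹) atTop (𝓝 0) := by
    simpa using tendsto_inv_atTop_nhds_zero_nat.const_mul C
  have hk0 : Tendsto (fun n : ℕ => k * (C * (n : ℝ)⁻¹)) atTop (𝓝 0) := by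
    simpa using hn0.const_mul (k : ℝ)
  have hexp := Real.exp_pos (-(2 * C))
  filter_upwards [hn0.eventually_lt_const (show (0 : ℝ) < 1 / 2 by norm_num),
    hk0.eventually_lt_const (half_pos hexp), h2.eventually_lt_const (half_pos hexp),
    eventually_ge_atTop k] with n h3 h4 h5 h6
  refine hC.trans (not_lt.1 fun hlt => ?_)
  have hn : (0 : ℝ) < n := by exact_mod_cast hk.trans_le h6
  have h7 : p n ^ k < C * (n : ℝ)⁻¹ := by
    rw [← div_eq_mul_inv, lt_div_iff₀ hn, mul_comm]
    exact hlt
  have h8 : 0 ≤ p n ^ k := pow_nonneg (h0 n) k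
  have h9 : p n < 1 := by
    refine lt_of_le_of_ne (h1 n) fun h10 => ?_
    rw [h10, one_pow] at h7
    linarith
  have h10 := exp_le_pr_not_circRun (h0 n) h9 hk h6
  have h11 : Real.exp (-(2 * C)) ≤ Real.exp (-(n * p n ^ k / (1 - p n ^ k))) := by
    refine Real.exp_le_exp.2 (neg_le_neg ?_)
    rw [div_le_iff₀ (by linarith)]
    nlinarith
  have h12 : (k : ℝ) * p n ^ k ≤ k * (C * (n : ℝ)⁻¹) := by gcongr
  linarith

/-- A run at one fixed place already has probability `p n ^ k`, so this tends to zero and eventually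
`1 - p n ≥ 1 / 2`. The logarithm of the exponential upper bound then controls `n * p n ^ k`. -/
theorem tendsto_mul_pow_zero_of_pr_circRun (hk : 0 < k) (h0 : ∀ n, 0 ≤ p n) (h1 : ∀ n, p n ≤ 1)
    (h : Tendsto (fun n => pr (p n) n (CircRun k)) atTop (𝓝 0)) :
    Tendsto (fun n : ℕ => n * p n ^ k) atTop (𝓝 0) := by
  have hpk : Tendsto (fun n => p n ^ k) atTop (𝓝 0) := by
    refine squeeze_zero' (Eventually.of_forall fun n => pow_nonneg (h0 n) k) ?_ h
    filter_upwards [eventually_ge_atTop k] with n hn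
    obtain ⟨m, rfl⟩ := Nat.exists_eq_add_of_le hn
    refine (le_pr_startsOnes (h0 _) (h1 _) k m).trans (pr_mono (h0 _) (h1 _) fun w _ hw => ?_)
    exact HasBlock.circRun hk ⟨0, fun j hj => by simpa using hw j hj⟩
  have hlog : Tendsto (fun n => -Real.log (1 - pr (p n) n (CircRun k))) atTop (𝓝 0) := by
    have h2 : Tendsto (fun n => 1 - pr (p n) n (CircRun k)) atTop (𝓝 1) := by
      simpa using h.const_sub 1
    simpa using (h2.log one_ne_zero).neg
  have hup : Tendsto (fun n => 2 * -Real.log (1 - pr (p n) n (CircRun k)) + k * p n ^ k) atTop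
      (𝓝 0) := by
    simpa using (hlog.const_mul 2).add (hpk.const_mul (k : ℝ))
  refine squeeze_zero' (Eventually.of_forall fun n =>
    mul_nonneg (Nat.cast_nonneg n) (pow_nonneg (h0 n) k)) ?_ hup
  have hhalf : (0 : ℝ) < (1 / 2) ^ k := by positivity
  filter_upwards [eventually_ge_atTop k, hpk.eventually_lt_const hhalf,
    h.eventually_lt_const one_pos] with n hn h2 h3
  have h4 : p n ≤ 1 / 2 := (lt_of_pow_lt_pow_left₀ k (by norm_num) h2).le
  have h5 := pr_not_circRun_le_exp (h0 n) (h1 n) hk hn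
  rw [pr_not, ← Real.log_le_iff_le_exp (by linarith)] at h5
  have h6 : 0 ≤ n * p n ^ k - k * p n ^ k := by
    rw [← sub_mul]
    exact mul_nonneg (sub_nonneg.2 (by exact_mod_cast hn)) (pow_nonneg (h0 n) k)
  nlinarith

/-- The least `k` whose run probability does not tend to one is the upper end of the window; if none
exists, all `n * p n ^ k` diverge. -/
theorem trichotomy_of_pr_circRun (h0 : ∀ n, 0 ≤ p n) (h1 : ∀ n, p n ≤ 1)
    (h : ∀ k, 0 < k → Tendsto (fun n => pr (p n) n (CircRun k)) atTop (𝓝 0) ∨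
      Tendsto (fun n => pr (p n) n (CircRun k)) atTop (𝓝 1)) :
    Tendsto (fun n : ℕ => n * p n ^ 1) atTop (𝓝 0) ∨
    (∃ k : ℕ, 0 < k ∧ Tendsto (fun n : ℕ => n * p n ^ k) atTop atTop ∧
      Tendsto (fun n : ℕ => n * p n ^ (k + 1)) atTop (𝓝 0)) ∨
    ∀ k : ℕ, 0 < k → Tendsto (fun n : ℕ => n * p n ^ k) atTop atTop := by
  classical
  by_cases hall : ∀ k, 0 < k → Tendsto (fun n => pr (p n) n (CircRun k)) atTop (𝓝 1)
  · exact Or.inr (Or.inr fun k hk => tendsto_mul_pow_atTop_of_pr_circRun hk h0 h1 (hall k hk))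
  push Not at hall
  have hspec := Nat.find_spec hall
  have hzero := tendsto_mul_pow_zero_of_pr_circRun hspec.1 h0 h1
    ((h _ hspec.1).resolve_right hspec.2)
  obtain ⟨k, hk⟩ := Nat.exists_eq_succ_of_ne_zero hspec.1.ne'
  rw [hk] at hzero
  rcases Nat.eq_zero_or_pos k with rfl | hk0
  · exact Or.inl hzero
  · have hmin := Nat.find_min hall (m := k) (by omega)
    push Not at hmin
    exact Or.inr (Or.inl ⟨k, hk0, tendsto_mul_pow_atTop_of_pr_circRun hk0 h0 h1 (hmin hk0), hzero⟩)

end RunLimits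

theorem favourable_of_window {p : ℕ → ℝ} (h0 : ∀ n, 0 ≤ p n) {k : ℕ} (hk : 0 < k)
    (h : Tendsto (fun n : ℕ => n * p n ^ k) atTop atTop)
    (h' : Tendsto (fun n : ℕ => n * p n ^ (k + 1)) atTop (𝓝 0)) : Favourable p := by
  refine Or.inr (Or.inl ⟨k, tendsto_nhdsWithin_iff.2
    ⟨tendsto_zero_of_mul_pow k.succ_pos h0 h', ?_⟩, h, h'⟩)
  filter_upwards [h.eventually_gt_atTop 0] with n hn
  refine lt_of_le_of_ne (h0 n) fun h2 => ?_
  rw [← h2, zero_pow hk.ne', mul_zero] at hn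
  exact lt_irrefl _ hn

theorem favourable_of_rich {p : ℕ → ℝ} (h0 : ∀ n, 0 ≤ p n) (h1 : ∀ n, p n ≤ 1)
    (h : ∀ k : ℕ, 0 < k → Tendsto (fun n : ℕ => n * p n ^ k) atTop atTop)
    (h' : ∀ k : ℕ, 0 < k → Tendsto (fun n : ℕ => n * (1 - p n) ^ k) atTop atTop) :
    Favourable p := by
  refine Or.inr (Or.inr fun L => ?_)
  rcases Nat.eq_zero_or_pos L with rfl | hL
  · simpa using tendsto_natCast_atTop_atTop (R := ℝ)
  -- The target is the geometric mean of `n * p n ^ (2 * L)` and `n * (1 - p n) ^ (2 * L)`.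
  · refine (Real.tendsto_sqrt_atTop.comp ((h (L * 2) (by omega)).atTop_mul_atTop₀
      (h' (L * 2) (by omega)))).congr fun n => ?_
    have : n * p n ^ (L * 2) * (n * (1 - p n) ^ (L * 2)) = (n * (p n * (1 - p n)) ^ L) ^ 2 := by
      rw [mul_pow (p n), pow_mul, pow_mul]; ring
    rw [Function.comp_apply, this, Real.sqrt_sq]
    exact mul_nonneg (Nat.cast_nonneg n)
      (pow_nonneg (mul_nonneg (h0 n) (sub_nonneg.2 (h1 n))) L)

theorem zeroOneLaw_iff (p : ℕ → unitInterval) : ZeroOneLaw p ↔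
    Tendsto (fun n : ℕ => n * (p n : ℝ) ^ 1) atTop (𝓝 0) ∨
    (∃ k : ℕ, 0 < k ∧ Tendsto (fun n : ℕ => n * (p n : ℝ) ^ k) atTop atTop ∧
      Tendsto (fun n : ℕ => n * (p n : ℝ) ^ (k + 1)) atTop (𝓝 0)) ∨
    ((∀ k : ℕ, 0 < k → Tendsto (fun n : ℕ => n * (p n : ℝ) ^ k) atTop atTop) ∧
      ∀ k : ℕ, 0 < k → Tendsto (fun n : ℕ => n * (1 - (p n : ℝ)) ^ k) atTop atTop) ∨
    (∃ k : ℕ, 0 < k ∧ Tendsto (fun n : ℕ => n * (1 - (p n : ℝ)) ^ k) atTop atTop ∧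
      Tendsto (fun n : ℕ => n * (1 - (p n : ℝ)) ^ (k + 1)) atTop (𝓝 0)) ∨
    Tendsto (fun n : ℕ => n * (1 - (p n : ℝ)) ^ 1) atTop (𝓝 0) := by
  have h0 : ∀ n, 0 ≤ (p n : ℝ) := fun n => (p n).2.1
  have h1 : ∀ n, (p n : ℝ) ≤ 1 := fun n => (p n).2.2
  have h0' : ∀ n, 0 ≤ 1 - (p n : ℝ) := fun n => sub_nonneg.2 (h1 n)
  have h1' : ∀ n, 1 - (p n : ℝ) ≤ 1 := fun n => by linarith [h0 n]
  constructor
  · intro h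
    have h2 := trichotomy_of_pr_circRun h0 h1 fun k hk => by
      refine (h (runSentence k true)).imp ?_ ?_ <;>
      · refine fun h => h.congr' ?_
        filter_upwards [eventually_ge_atTop k] with n hn
        exact prob_runSentence_true hk hn (p n)
    have h3 := trichotomy_of_pr_circRun h0' h1' fun k hk => by
      refine (h (runSentence k false)).imp ?_ ?_ <;>
      · refine fun h => h.congr' ?_
        filter_upwards [eventually_ge_atTop k] with n hn
        exact prob_runSentence_false hk hn (p n)
    rcases h2 with h2 | h2 | h2
    · exact Or.inl h2
    · exact Or.inr (Or.inl h2)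
    -- All `n * p n ^ k` diverge, so the trichotomy for `1 - p` decides among the last three ranges.
    · rcases h3 with h3 | h3 | h3
      · exact Or.inr (Or.inr (Or.inr (Or.inr h3)))
      · exact Or.inr (Or.inr (Or.inr (Or.inl h3)))
      · exact Or.inr (Or.inr (Or.inl ⟨h2, h3⟩))
  · rintro (h | ⟨k, hk, h, h'⟩ | ⟨h, h'⟩ | ⟨k, hk, h, h'⟩ | h)
    · exact zeroOneLaw_of_favourable (Or.inl (by simpa using h))
    · exact zeroOneLaw_of_favourable (favourable_of_window h0 hk h h')
    · exact zeroOneLaw_of_favourable (favourable_of_rich h0 h1 h h')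
    · exact zeroOneLaw_of_favourable_compl (favourable_of_window h0' hk h h')
    · exact zeroOneLaw_of_favourable_compl (Or.inl (by simpa using h))

theorem exists_limit_runSentence {k : ℕ} (hk : 0 < k) {c : ℝ} (hc : 0 < c)
    {p : ℕ → unitInterval}
    (hp : (fun n => (p n : ℝ)) ~[atTop] (fun n : ℕ => c * (n : ℝ) ^ (-(1 / (k : ℝ))))) :
    ∃ L : ℝ, 0 < L ∧ L < 1 ∧
      Tendsto (fun n => prob n (p n) (runSentence k true)) atTop (𝓝 L) := by
  have hlim : Tendsto (fun n : ℕ => n * (p n : ℝ) ^ k) atTop (𝓝 (c ^ k)) := by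
    have hne : ∀ᶠ n : ℕ in atTop, c * (n : ℝ) ^ (-(1 / (k : ℝ))) ≠ 0 := by
      filter_upwards [eventually_gt_atTop 0] with n hn
      positivity
    have h2 := (((isEquivalent_iff_tendsto_one hne).1 hp).const_mul c).pow k
    rw [mul_one] at h2
    refine h2.congr fun n => ?_
    rw [← div_rpow_neg_inv_pow hk]
    congr 1
    rw [Pi.div_apply]
    field_simp
  have hck : 0 < c ^ k := by positivity
  refine ⟨1 - Real.exp (-c ^ k), ?_, ?_, ?_⟩
  · rw [sub_pos, Real.exp_lt_one_iff]
    linarith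
  · linarith [Real.exp_pos (-c ^ k)]
  · refine (tendsto_pr_circRun hk (fun n => (p n).2.1) (fun n => (p n).2.2) hlim).congr' ?_
    filter_upwards [eventually_ge_atTop k] with n hn
    exact (prob_runSentence_true hk hn (p n)).symm

end CircularPredicate


theorem theorem1 :
    (∀ p : ℕ → unitInterval,
      CircularPredicate.ZeroOneLaw p ↔
        ((fun n => (p n : ℝ)) =o[atTop] (fun n : ℕ => (n : ℝ) ^ (-1 : ℝ))) ∨
        (∃ k : ℕ, 0 < k ∧
          ((fun n : ℕ => (n : ℝ) ^ (-(1 / (k : ℝ)))) =o[atTop] (fun n => (p n : ℝ))) ∧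
          ((fun n => (p n : ℝ)) =o[atTop] (fun n : ℕ => (n : ℝ) ^ (-(1 / ((k : ℝ) + 1)))))) ∨
        (∀ ε : ℝ, 0 < ε →
          ((fun n : ℕ => (n : ℝ) ^ (-ε)) =o[atTop] (fun n => (p n : ℝ))) ∧
          ((fun n : ℕ => (n : ℝ) ^ (-ε)) =o[atTop] (fun n => 1 - (p n : ℝ)))) ∨
        (∃ k : ℕ, 0 < k ∧
          ((fun n : ℕ => (n : ℝ) ^ (-(1 / (k : ℝ)))) =o[atTop] (fun n => 1 - (p n : ℝ))) ∧
          ((fun n => 1 - (p n : ℝ)) =o[atTop] (fun n : ℕ => (n : ℝ) ^ (-(1 / ((k : ℝ) + 1)))))) ∨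
        ((fun n => 1 - (p n : ℝ)) =o[atTop] (fun n : ℕ => (n : ℝ) ^ (-1 : ℝ)))) ∧
    (∀ k : ℕ, 0 < k →
      ∃ A : CircularPredicate.circular.Sentence,
        (∀ n : ℕ, k ≤ n → ∀ U : Set (Fin n),
          CircularPredicate.Holds n U A ↔ CircularPredicate.HasRun k n U) ∧
        ∀ (c : ℝ), 0 < c → ∀ p : ℕ → unitInterval,
          ((fun n => (p n : ℝ)) ~[atTop] (fun n : ℕ => c * (n : ℝ) ^ (-(1 / (k : ℝ))))) →
          ∃ L : ℝ, 0 < L ∧ L < 1 ∧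
            Tendsto (fun n => CircularPredicate.prob n (p n) A) atTop (𝓝 L)) := by
  open CircularPredicate in
  refine ⟨fun p => ?_, fun k hk => ⟨runSentence k true, fun n hn U => ?_, fun c hc p hp =>
    exists_limit_runSentence hk hc hp⟩⟩
  · have h0 : ∀ n, 0 ≤ (p n : ℝ) := fun n => (p n).2.1
    have h0' : ∀ n, 0 ≤ 1 - (p n : ℝ) := fun n => sub_nonneg.2 (p n).2.2
    rw [zeroOneLaw_iff]
    have hone : (-1 : ℝ) = -(1 / ((1 : ℕ) : ℝ)) := by norm_num
    have hsucc : ∀ k : ℕ, (k : ℝ) + 1 = ((k + 1 : ℕ) : ℝ) := fun k => by push_cast; rfl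
    simp only [forall_and, ← forall_rpow_isLittleO_iff h0, ← forall_rpow_isLittleO_iff h0']
    rw [hone]
    simp only [hsucc, isLittleO_rpow_iff one_pos h0, isLittleO_rpow_iff one_pos h0',
      isLittleO_rpow_iff (Nat.succ_pos _) h0, isLittleO_rpow_iff (Nat.succ_pos _) h0']
    refine or_congr Iff.rfl (or_congr (exists_congr fun k => and_congr_right fun hk =>
      and_congr (rpow_isLittleO_iff hk h0).symm Iff.rfl) (or_congr ?_ (or_congr
      (exists_congr fun k => and_congr_right fun hk =>
      and_congr (rpow_isLittleO_iff hk h0').symm Iff.rfl) Iff.rfl)))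
    rfl
  · rw [holds_runSentence hk hn]
    simp
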